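/- Let $(\tilde M,\phi,\xi,\eta,g)$ be a $(2m+1)$-dimensional contact metric manifold, that is, a smooth manifold with a smooth $(1,1)$-tensor field $\phi$, vector field $\xi$, $1$-form $\eta$ and Riemannian metric $g=\langle\cdot,\cdot\rangle$ such that $\phi^2=-I+\eta\otimes\xi$, $\eta(\xi)=1$, $\phi\xi=0$, $\eta\circ\phi=0$, $\langle X,Y\rangle=\langle\phi X,\phi Y\rangle+\eta(X)\eta(Y)$, $\langle X,\phi Y\rangle=-\langle\phi X,Y\rangle$, $\langle X,\xi\rangle=\eta(X)$, and $d\eta(X,Y)=\langle X,\phi Y\rangle$, where $d\eta(X,Y)=\frac12\left(X\eta(Y)-Y\eta(X)-\eta([X,Y])\right)$. Put $h=\frac12\mathcal L_\xi\phi$. Suppose that $\tilde M$ is a generalized $(\kappa,\mu)$-space form with divided $R_5$: there are functions $f_1,f_2,f_3,f_4,f_{5,1},f_{5,2},f_6$ on $\tilde M$ such that the curvature tensor $\tilde R(X,Y)Z=\tilde\nabla_X\tilde\nabla_YZ-\tilde\nabla_Y\tilde\nabla_XZ-\tilde\nabla_{[X,Y]}Z$ equals $f_1R_1+f_2R_2+f_3R_3+f_4R_4+f_{5,1}R_{5,1}+f_{5,2}R_{5,2}+f_6R_6$,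 where \begin{align*} R_1(X,Y)Z&=\langle Y,Z\rangle X-\langle X,Z\rangle Y,\\ R_2(X,Y)Z&=\langle X,\phi Z\rangle\phi Y-\langle Y,\phi Z\rangle\phi X+2\langle X,\phi Y\rangle\phi Z,\\ R_3(X,Y)Z&=\eta(X)\eta(Z)Y-\eta(Y)\eta(Z)X+\langle X,Z\rangle\eta(Y)\xi-\langle Y,Z\rangle\eta(X)\xi,\\ R_4(X,Y)Z&=\langle Y,Z\rangle hX-\langle X,Z\rangle hY+\langle hY,Z\rangle X-\langle hX,Z\rangle Y,\\ R_{5,1}(X,Y)Z&=\langle hY,Z\rangle hX-\langle hX,Z\rangle hY,\\ R_{5,2}(X,Y)Z&=\langle\phi hY,Z\rangle\phi hX-\langle\phi hX,Z\rangle\phi hY,\\ R_6(X,Y)Z&=\eta(X)\eta(Z)hY-\eta(Y)\eta(Z)hX+\langle hX,Z\rangle\eta(Y)\xi-\langle hY,Z\rangle\eta(X)\xi. \end{align*} Let $M$ be an $n$-dimensional ($n\ge 2$) isometrically immersed submanifold of $\tilde M$ that is C-totally real, i.e. $\eta$ vanishes on every tangent vector of $M$. Let $\sigma(X,Y)=\tilde\nabla_XY-\nabla_XY$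 be its second fundamental form, $H=\frac1n\operatorname{tr}\sigma$ its mean curvature vector, and, for $X$ tangent to $M$, let $h^TX$ and $(\phi h)^TX$ be the components of $hX$ and $\phi hX$ tangent to $M$. Let $\operatorname{Ric}(U)$ be the Ricci curvature of the induced metric in the direction of a unit vector $U\in T_pM$, i.e. the sum of the sectional curvatures of the planes spanned by $U$ and each of the other members of an orthonormal basis of $T_pM$ that contains $U$. Then, for each point $p\in M$: 1. For every unit vector $U\in T_pM$, \begin{align*} \operatorname{Ric}(U)\le{}&\tfrac14n^2\|H\|^2+(n-1)f_1+f_4\left(\operatorname{tr}(h^T)+(n-2)\langle h^TU,U\rangle\right)\\ &+f_{5,1}\left(\operatorname{tr}(h^T)\langle h^TU,U\rangle-\|h^TU\|^2\right)\\ &+f_{5,2}\left(\operatorname{tr}((\phi h)^T)\langle(\phi h)^TU,U\rangle-\|(\phi h)^TU\|^2\right),\qquad(*) \end{align*} where all functions are evaluated at $p$. 2. If $H(p)=0$, a unit vector $U\in T_pM$ satisfies equality in $(*)$ if and only if $U$ lies in the relative null space $\mathcal N_p=\{X\in T_pM:\sigma(X,Y)=0\text{ for all }Y\in T_pM\}$.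 3. Equality in $(*)$ holds for all unit vectors $U\in T_pM$ if and only if either $p$ is a totally geodesic point ($\sigma=0$ at $p$), or $n=2$ and $p$ is a totally umbilical point ($\sigma(X,Y)=\langle X,Y\rangle H$ for all $X,Y\in T_pM$). -/

import Mathlib

open scoped Manifold ContDiff Topology
open Bundle

noncomputable section

namespace KappaMu

/-! ### Local Riemannian geometry on an open part of a vector space -/

section Coordinates

variable {E : Type*} [NormedAddCommGroup E] [NormedSpace ℝ E]

set_option maxSynthPendingDepth 4 in
/-- The Christoffel symbols of the first kind of the metric `G`:
`(u, v, w) ↦ (D_u G (v, w) + D_v G (u, w) - D_w G (u, v)) / 2`. -/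
def christoffelFirst (G : E → E →L[ℝ] E →L[ℝ] ℝ) (y : E) : E →L[ℝ] E →L[ℝ] E →L[ℝ] ℝ :=
  let D : E →L[ℝ] E →L[ℝ] E →L[ℝ] ℝ := fderiv ℝ G y
  let S : (E →L[ℝ] E →L[ℝ] ℝ) →L[ℝ] (E →L[ℝ] E →L[ℝ] ℝ) :=
    (ContinuousLinearMap.flipₗᵢ ℝ E E ℝ).toContinuousLinearEquiv.toContinuousLinearMap
  (2⁻¹ : ℝ) • (D + D.flip - S.comp D.flip)

set_option maxSynthPendingDepth 4 in
theorem christoffelFirst_apply (G : E → E →L[ℝ] E →L[ℝ] ℝ) (y u v w : E) :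
    christoffelFirst G y u v w =
      2⁻¹ * (fderiv ℝ G y u v w + fderiv ℝ G y v u w - fderiv ℝ G y w u v) := by
  simp [christoffelFirst]

/-- The Christoffel symbols `Γ(u, v)` of the Levi-Civita connection of the metric `G`; they are
determined by `G (Γ(u, v), w) = christoffelFirst G u v w`, and the Levi-Civita connection is
`∇_X Y = DY(X) + Γ(X, Y)`. -/
def christoffel (G : E → E →L[ℝ] E →L[ℝ] ℝ) (y : E) : E →L[ℝ] E →L[ℝ] E :=
  (ContinuousLinearMap.compL ℝ E (E →L[ℝ] ℝ) E (G y).inverse).comp (christoffelFirst G y)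

theorem christoffel_apply (G : E → E →L[ℝ] E →L[ℝ] ℝ) (y u v : E) :
    christoffel G y u v = (G y).inverse (christoffelFirst G y u v) := rfl

/-- The curvature `R(u, v) w = ∇_u ∇_v w - ∇_v ∇_u w - ∇_[u,v] w` of the connection
`∇_X Y = DY(X) + Γ(X, Y)`, for fields `u, v, w` with constant coefficients. -/
def coordCurvature (Γ : E → E →L[ℝ] E →L[ℝ] E) (y u v w : E) : E :=
  fderiv ℝ Γ y u v w - fderiv ℝ Γ y v u w + Γ y u (Γ y v w) - Γ y v (Γ y u w)

set_option maxSynthPendingDepth 4 in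
theorem coordCurvature_add (Γ : E → E →L[ℝ] E →L[ℝ] E) (y u u' v w : E) :
    coordCurvature Γ y (u + u') v w = coordCurvature Γ y u v w + coordCurvature Γ y u' v w := by
  simp only [coordCurvature, map_add, add_apply]
  abel

set_option maxSynthPendingDepth 4 in
theorem coordCurvature_smul (Γ : E → E →L[ℝ] E →L[ℝ] E) (y : E) (c : ℝ) (u v w : E) :
    coordCurvature Γ y (c • u) v w = c • coordCurvature Γ y u v w := by
  simp only [coordCurvature, map_smul, smul_apply, smul_sub, smul_add]

/-- The Lie derivative `L_ξ φ` of a field `φ` of endomorphisms. -/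
def coordLieDerivEnd (ξ : E → E) (φ : E → E →L[ℝ] E) (y : E) : E →L[ℝ] E :=
  fderiv ℝ φ y (ξ y) - (fderiv ℝ ξ y).comp (φ y) + (φ y).comp (fderiv ℝ ξ y)

/-- `(L_ξ φ) X = [ξ, φ X] - φ [ξ, X]`. -/
theorem coordLieDerivEnd_apply {ξ : E → E} {φ : E → E →L[ℝ] E} {X : E → E} {y : E}
    (hφ : DifferentiableAt ℝ φ y) (hX : DifferentiableAt ℝ X y) :
    coordLieDerivEnd ξ φ y (X y) =
      VectorField.lieBracket ℝ ξ (fun z => φ z (X z)) y -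
        φ y (VectorField.lieBracket ℝ ξ X y) := by
  have h : HasFDerivAt (fun z => φ z (X z)) _ y := hφ.hasFDerivAt.clm_apply hX.hasFDerivAt
  simp only [coordLieDerivEnd, VectorField.lieBracket, h.fderiv]
  simp
  abel

/-- The second fundamental form of an isometric immersion `F` in coordinates, by the Gauss formula
`σ(u, v) = ∇'_u v - ∇_u v`, that is `σ(u, v) = D²F(u, v) + Γ'(DF u, DF v) - DF (Γ(u, v))`, where
`Γ` and `Γ'` are the Christoffel symbols of the two metrics. -/
def coordSecondForm {E' : Type*} [NormedAddCommGroup E'] [NormedSpace ℝ E']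
    (Γ : E → E →L[ℝ] E →L[ℝ] E) (Γ' : E' → E' →L[ℝ] E' →L[ℝ] E') (F : E → E') (y u v : E) : E' :=
  fderiv ℝ (fderiv ℝ F) y u v + Γ' (F y) (fderiv ℝ F y u) (fderiv ℝ F y v) -
    fderiv ℝ F y (Γ y u v)

/-- The expansion of a vector in an orthonormal basis of a finite-dimensional space. -/
theorem expand_of_orthonormal [FiniteDimensional ℝ E] {d : ℕ} (hd : Module.finrank ℝ E = d) (B : E →L[ℝ] E →L[ℝ] ℝ)
    (e : Fin d → E) (he : ∀ i j, B (e i) (e j) = if i = j then 1 else 0) (v : E) :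
    ∑ j, B v (e j) • e j = v := by
  have hli : LinearIndependent ℝ e := by
    rw [Fintype.linearIndependent_iff]
    intro c hc i
    have h := congrArg (fun w => B w (e i)) hc
    simpa [map_sum, he] using h
  have hsp : v ∈ Submodule.span ℝ (Set.range e) := by
    rw [hli.span_eq_top_of_card_eq_finrank' (by simp [hd])]
    trivial
  obtain ⟨c, rfl⟩ := (Submodule.mem_span_range_iff_exists_fun ℝ).1 hsp
  refine Finset.sum_congr rfl fun j _ => ?_
  congr 1
  simp [map_sum, he]

/-- The inverse of a metric in an orthonormal basis. -/
theorem inverse_of_orthonormal [FiniteDimensional ℝ E] {d : ℕ} (hd : Module.finrank ℝ E = d) (B : E →L[ℝ] E →L[ℝ] ℝ)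
    (e : Fin d → E) (he : ∀ i j, B (e i) (e j) = if i = j then 1 else 0) (hB : ∀ u v, B u v = B v u)
    (α : E →L[ℝ] ℝ) : B.inverse α = ∑ k, α (e k) • e k := by
  have hexp := expand_of_orthonormal hd B e he
  let s : (E →L[ℝ] ℝ) →L[ℝ] E :=
    ∑ k, (ContinuousLinearMap.apply ℝ ℝ (e k)).smulRight (e k)
  have hs : ∀ α : E →L[ℝ] ℝ, s α = ∑ k, α (e k) • e k := fun α => by simp [s, sum_apply]
  let T : E ≃L[ℝ] (E →L[ℝ] ℝ) := ContinuousLinearEquiv.equivOfInverse B s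
    (fun v => by rw [hs, hexp]) (fun α => by
      ext v
      conv_rhs => rw [← hexp v]
      simp [hs, map_sum, sum_apply, mul_comm, hB v])
  have hT : B = (T : E →L[ℝ] (E →L[ℝ] ℝ)) := rfl
  rw [hT, ContinuousLinearMap.inverse_equiv]
  exact hs α

end Coordinates

/-! ### Riemannian manifolds -/

/-- The model space of `d`-dimensional manifolds. -/
abbrev Eu (d : ℕ) : Type := EuclideanSpace ℝ (Fin d)

section Riemannian

variable {d : ℕ} {M : Type*} [TopologicalSpace M] [ChartedSpace (Eu d) M]

/-- The derivative at `y` of the inverse of the preferred chart at `p`: it sends a vector with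
constant coefficients in this chart to the tangent vector it represents at the point with
coordinates `y`. Over `p` itself it is the identity, as `TangentSpace (𝓡 d) p` is `Eu d`, read in
the preferred chart at `p`. -/
def chartFrame (p : M) (y : Eu d) :
    Eu d →L[ℝ] TangentSpace (𝓡 d) ((extChartAt (𝓡 d) p).symm y) :=
  mfderivWithin 𝓘(ℝ, Eu d) (𝓡 d) (extChartAt (𝓡 d) p).symm (Set.range (𝓡 d)) y

/-- A vector field in the preferred chart at `p`. -/
def vectorInChart (p : M) (ξ : ∀ x : M, TangentSpace (𝓡 d) x) (y : Eu d) : Eu d :=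
  (chartFrame p y).inverse (ξ ((extChartAt (𝓡 d) p).symm y))

/-- A 1-form in the preferred chart at `p`. -/
def formInChart (p : M) (η : ∀ x : M, TangentSpace (𝓡 d) x →L[ℝ] ℝ) (y : Eu d) :
    Eu d →L[ℝ] ℝ :=
  (η ((extChartAt (𝓡 d) p).symm y)).comp (chartFrame p y)

/-- A (1,1)-tensor field in the preferred chart at `p`. -/
def endInChart (p : M) (φ : ∀ x : M, TangentSpace (𝓡 d) x →L[ℝ] TangentSpace (𝓡 d) x)
    (y : Eu d) : Eu d →L[ℝ] Eu d :=
  (chartFrame p y).inverse.comp ((φ ((extChartAt (𝓡 d) p).symm y)).comp (chartFrame p y))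

/-- The exterior derivative of a 1-form, with the normalization
`dη(X, Y) = (X η(Y) - Y η(X) - η([X, Y])) / 2`. -/
def extDerivForm (η : ∀ x : M, TangentSpace (𝓡 d) x →L[ℝ] ℝ) (p : M)
    (X Y : TangentSpace (𝓡 d) p) : ℝ :=
  2⁻¹ * (fderiv ℝ (formInChart p η) (extChartAt (𝓡 d) p p) X Y -
    fderiv ℝ (formInChart p η) (extChartAt (𝓡 d) p p) Y X)

/-- The Lie derivative `L_ξ φ` of a (1,1)-tensor field. -/
def lieDerivEnd (ξ : ∀ x : M, TangentSpace (𝓡 d) x)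
    (φ : ∀ x : M, TangentSpace (𝓡 d) x →L[ℝ] TangentSpace (𝓡 d) x) (p : M) :
    TangentSpace (𝓡 d) p →L[ℝ] TangentSpace (𝓡 d) p :=
  coordLieDerivEnd (E := Eu d) (vectorInChart p ξ) (endInChart p φ) (extChartAt (𝓡 d) p p)

variable [IsManifold (𝓡 d) ∞ M]

variable (d M) in
/-- Smooth Riemannian metrics on a `d`-dimensional manifold. -/
abbrev Metric : Type _ :=
  ContMDiffRiemannianMetric (𝓡 d) ∞ (Eu d) (fun x : M => TangentSpace (𝓡 d) x)

/-- A Riemannian metric in the preferred chart at `p`. -/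
def metricInChart (g : Metric d M) (p : M) (y : Eu d) : Eu d →L[ℝ] Eu d →L[ℝ] ℝ :=
  ContinuousLinearMap.bilinearComp (E := Eu d) (F := Eu d)
    (g.inner ((extChartAt (𝓡 d) p).symm y)) (chartFrame p y) (chartFrame p y)

/-- The Riemannian curvature tensor at `p`, with
`R(X, Y) Z = ∇_X ∇_Y Z - ∇_Y ∇_X Z - ∇_[X,Y] Z`. -/
def curvature (g : Metric d M) (p : M) (X Y Z : TangentSpace (𝓡 d) p) : TangentSpace (𝓡 d) p :=
  coordCurvature (E := Eu d) (christoffel (metricInChart g p)) (extChartAt (𝓡 d) p p) X Y Z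

/-- The sectional curvature of the plane section spanned by `X` and `Y`. -/
def sectional (g : Metric d M) (p : M) (X Y : TangentSpace (𝓡 d) p) : ℝ :=
  g.inner p (curvature g p X Y Y) X /
    (g.inner p X X * g.inner p Y Y - g.inner p X Y ^ 2)

/-- The operator `Z ↦ R(Z, U) U`. -/
def jacobiOperator (g : Metric d M) (p : M) (U : TangentSpace (𝓡 d) p) :
    TangentSpace (𝓡 d) p →ₗ[ℝ] TangentSpace (𝓡 d) p where
  toFun Z := curvature g p Z U U
  map_add' Z Z' := coordCurvature_add (E := Eu d) _ _ Z Z' U U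
  map_smul' c Z := coordCurvature_smul (E := Eu d) _ _ c Z U U

/-- The Ricci curvature `Ric(U)`, the trace of `Z ↦ R(Z, U) U`. For a unit vector `U` it is
the sum of the sectional curvatures of the planes spanned by `U` and the other members of an
orthonormal basis that contains `U`: see `ricci_eq_sum_sectional`. -/
def ricci (g : Metric d M) (p : M) (U : TangentSpace (𝓡 d) p) : ℝ :=
  LinearMap.trace ℝ (TangentSpace (𝓡 d) p) (jacobiOperator g p U)

/-- `e` is an orthonormal basis of the tangent space at `p`. -/
def IsOrthonormalFrame (g : Metric d M) (p : M) (e : Fin d → TangentSpace (𝓡 d) p) : Prop :=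
  ∀ i j, g.inner p (e i) (e j) = if i = j then 1 else 0

/-- The trace with respect to the metric, `∑ g^{ij} B(∂_i, ∂_j)`, of a bilinear map on the tangent
space at `p`. It is `∑ B(e_i, e_i)` for every orthonormal basis `e`: see `metricTrace_eq_sum`. -/
def metricTrace {W : Type*} [AddCommGroup W] (g : Metric d M) (p : M)
    (B : TangentSpace (𝓡 d) p → TangentSpace (𝓡 d) p → W) : W :=
  ∑ i : Fin d, B (EuclideanSpace.single i (1 : ℝ) : Eu d)
    ((g.inner p).inverse (EuclideanSpace.proj i : Eu d →L[ℝ] ℝ))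

theorem expand_of_isOrthonormalFrame {g : Metric d M} {p : M}
    {e : Fin d → TangentSpace (𝓡 d) p} (he : IsOrthonormalFrame g p e)
    (v : TangentSpace (𝓡 d) p) : ∑ j, g.inner p v (e j) • e j = v :=
  expand_of_orthonormal (E := Eu d) (by simp) (g.inner p) e he v

theorem inverse_of_isOrthonormalFrame {g : Metric d M} {p : M}
    {e : Fin d → TangentSpace (𝓡 d) p} (he : IsOrthonormalFrame g p e)
    (α : TangentSpace (𝓡 d) p →L[ℝ] ℝ) : (g.inner p).inverse α = ∑ k, α (e k) • e k :=
  inverse_of_orthonormal (E := Eu d) (by simp) (g.inner p) e he (g.symm p) α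

theorem metricTrace_eq_sum {W : Type*} [AddCommGroup W] [Module ℝ W] {g : Metric d M} {p : M}
    {e : Fin d → TangentSpace (𝓡 d) p} (he : IsOrthonormalFrame g p e)
    (B : TangentSpace (𝓡 d) p →ₗ[ℝ] TangentSpace (𝓡 d) p →ₗ[ℝ] W) :
    metricTrace g p (fun u v => B u v) = ∑ i, B (e i) (e i) := by
  have key : ∀ (B : Eu d →ₗ[ℝ] Eu d →ₗ[ℝ] W) (e : Fin d → Eu d),
      ∑ i : Fin d, B (EuclideanSpace.single i (1 : ℝ)) (∑ k, e k i • e k) =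
        ∑ k, B (e k) (e k) := by
    intro B e
    have hv : ∀ k, ∑ i : Fin d, e k i • (EuclideanSpace.single i (1 : ℝ) : Eu d) = e k := by
      intro k
      ext j
      simp [Pi.single_apply]
    simp only [map_sum, map_smul]
    rw [Finset.sum_comm]
    refine Finset.sum_congr rfl fun k _ => ?_
    simpa [map_sum, LinearMap.sum_apply] using congrArg (fun w => B w (e k)) (hv k)
  have h : ∀ i : Fin d, (g.inner p).inverse (EuclideanSpace.proj i : Eu d →L[ℝ] ℝ) =
      ∑ k, (show Eu d from e k) i • e k := fun i => inverse_of_isOrthonormalFrame he _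
  unfold metricTrace
  simp only [h]
  exact key B e

theorem ricci_eq_sum_sectional {g : Metric d M} {p : M} {e : Fin d → TangentSpace (𝓡 d) p}
    (he : IsOrthonormalFrame g p e) (i : Fin d) :
    ricci g p (e i) = ∑ j ∈ Finset.univ.erase i, sectional g p (e j) (e i) := by
  have hli : LinearIndependent ℝ e := by
    rw [Fintype.linearIndependent_iff]
    intro c hc j
    have h := congrArg (fun w => g.inner p w (e j)) hc
    simpa [map_sum, sum_apply, he _ _] using h
  have hcard : Fintype.card (Fin d) = Module.finrank ℝ (TangentSpace (𝓡 d) p) := by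
    change _ = Module.finrank ℝ (Eu d)
    simp
  have : FiniteDimensional ℝ (TangentSpace (𝓡 d) p) :=
    inferInstanceAs (FiniteDimensional ℝ (Eu d))
  let b := basisOfLinearIndependentOfCardEqFinrank' e hli hcard
  have hb : ∀ j, b j = e j := fun j => by simp [b]
  have hr : ∀ v j, b.repr v j = g.inner p v (e j) := by
    intro v j
    conv_rhs => rw [← b.sum_repr v]
    simp [map_sum, sum_apply, hb, he _ _]
  have hs : ricci g p (e i) = ∑ j, g.inner p (curvature g p (e j) (e i) (e i)) (e j) := by
    unfold ricci
    rw [LinearMap.trace_eq_matrix_trace ℝ b, Matrix.trace]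
    refine Finset.sum_congr rfl fun j _ => ?_
    rw [Matrix.diag_apply, LinearMap.toMatrix_apply, hr, hb]
    rfl
  have h0 : curvature g p (e i) (e i) (e i) = 0 := by
    have : ∀ (Γ : Eu d → Eu d →L[ℝ] Eu d →L[ℝ] Eu d) (y u : Eu d),
        coordCurvature Γ y u u u = 0 := fun Γ y u => by simp [coordCurvature]
    exact this _ _ _
  rw [hs, ← Finset.add_sum_erase _ _ (Finset.mem_univ i), h0]
  simp only [map_zero, zero_apply, zero_add]
  refine Finset.sum_congr rfl fun j hj => ?_
  have hji : j ≠ i := Finset.ne_of_mem_erase hj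
  simp [sectional, he _ _, hji]

end Riemannian

/-! ### Contact metric manifolds -/

section Contact

variable (m : ℕ) (N : Type*) [TopologicalSpace N] [ChartedSpace (Eu (2 * m + 1)) N]
  [IsManifold (𝓡 (2 * m + 1)) ∞ N]

/-- An almost contact metric structure `(φ, ξ, η, g)` on a `(2m+1)`-dimensional manifold. -/
structure AlmostContactMetric where
  g : Metric (2 * m + 1) N
  φ : ∀ x : N, TangentSpace (𝓡 (2 * m + 1)) x →L[ℝ] TangentSpace (𝓡 (2 * m + 1)) x
  ξ : ∀ x : N, TangentSpace (𝓡 (2 * m + 1)) x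
  η : ∀ x : N, TangentSpace (𝓡 (2 * m + 1)) x →L[ℝ] ℝ
  smooth_φ : ContMDiff (𝓡 (2 * m + 1))
    ((𝓡 (2 * m + 1)).prod 𝓘(ℝ, Eu (2 * m + 1) →L[ℝ] Eu (2 * m + 1))) ∞
    (fun x => TotalSpace.mk' (Eu (2 * m + 1) →L[ℝ] Eu (2 * m + 1)) x (φ x))
  smooth_ξ : ContMDiff (𝓡 (2 * m + 1)) ((𝓡 (2 * m + 1)).prod 𝓘(ℝ, Eu (2 * m + 1))) ∞
    (fun x => TotalSpace.mk' (Eu (2 * m + 1)) x (ξ x))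
  smooth_η : ContMDiff (𝓡 (2 * m + 1)) ((𝓡 (2 * m + 1)).prod 𝓘(ℝ, Eu (2 * m + 1) →L[ℝ] ℝ)) ∞
    (fun x => TotalSpace.mk' (Eu (2 * m + 1) →L[ℝ] ℝ) x (η x))
  φ_φ : ∀ x X, φ x (φ x X) = -X + η x X • ξ x
  η_ξ : ∀ x, η x (ξ x) = 1
  φ_ξ : ∀ x, φ x (ξ x) = 0
  η_φ : ∀ x X, η x (φ x X) = 0
  compatible : ∀ x X Y, g.inner x X Y = g.inner x (φ x X) (φ x Y) + η x X * η x Y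
  skew : ∀ x X Y, g.inner x X (φ x Y) = -g.inner x (φ x X) Y
  inner_ξ : ∀ x X, g.inner x X (ξ x) = η x X

variable {m N}

namespace AlmostContactMetric

variable (S : AlmostContactMetric m N)

/-- The structure is a contact metric structure: `dη = Φ`, where `Φ(X, Y) = g(X, φ Y)`. -/
def IsContactMetric : Prop :=
  ∀ x X Y, extDerivForm S.η x X Y = S.g.inner x X (S.φ x Y)

/-- The tensor field `h`, with `2 h = L_ξ φ`. -/
def h (x : N) : TangentSpace (𝓡 (2 * m + 1)) x →L[ℝ] TangentSpace (𝓡 (2 * m + 1)) x :=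
  (2⁻¹ : ℝ) • lieDerivEnd S.ξ S.φ x

/-! The tensors of which the curvature of a generalized `(κ, μ)`-space form is composed, as
`(X, Y, Z) ↦ R_i(X, Y) Z`. -/

variable (x : N) (X Y Z : TangentSpace (𝓡 (2 * m + 1)) x)

def R1 : TangentSpace (𝓡 (2 * m + 1)) x :=
  S.g.inner x Y Z • X - S.g.inner x X Z • Y

def R2 : TangentSpace (𝓡 (2 * m + 1)) x :=
  S.g.inner x X (S.φ x Z) • S.φ x Y - S.g.inner x Y (S.φ x Z) • S.φ x X +
    (2 * S.g.inner x X (S.φ x Y)) • S.φ x Z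

def R3 : TangentSpace (𝓡 (2 * m + 1)) x :=
  (S.η x X * S.η x Z) • Y - (S.η x Y * S.η x Z) • X +
    (S.g.inner x X Z * S.η x Y) • S.ξ x - (S.g.inner x Y Z * S.η x X) • S.ξ x

def R4 : TangentSpace (𝓡 (2 * m + 1)) x :=
  S.g.inner x Y Z • S.h x X - S.g.inner x X Z • S.h x Y +
    S.g.inner x (S.h x Y) Z • X - S.g.inner x (S.h x X) Z • Y

def R51 : TangentSpace (𝓡 (2 * m + 1)) x :=
  S.g.inner x (S.h x Y) Z • S.h x X - S.g.inner x (S.h x X) Z • S.h x Y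

def R52 : TangentSpace (𝓡 (2 * m + 1)) x :=
  S.g.inner x (S.φ x (S.h x Y)) Z • S.φ x (S.h x X) -
    S.g.inner x (S.φ x (S.h x X)) Z • S.φ x (S.h x Y)

def R6 : TangentSpace (𝓡 (2 * m + 1)) x :=
  (S.η x X * S.η x Z) • S.h x Y - (S.η x Y * S.η x Z) • S.h x X +
    (S.g.inner x (S.h x X) Z * S.η x Y) • S.ξ x - (S.g.inner x (S.h x Y) Z * S.η x X) • S.ξ x

/-- The manifold is a generalized `(κ, μ)`-space form with divided `R₅`: its curvature tensor is
`f₁ R₁ + f₂ R₂ + f₃ R₃ + f₄ R₄ + f₅₁ R₅₁ + f₅₂ R₅₂ + f₆ R₆`. -/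
def IsDividedSpaceForm (f₁ f₂ f₃ f₄ f₅₁ f₅₂ f₆ : N → ℝ) : Prop :=
  ∀ x X Y Z, curvature S.g x X Y Z =
    f₁ x • S.R1 x X Y Z + f₂ x • S.R2 x X Y Z + f₃ x • S.R3 x X Y Z + f₄ x • S.R4 x X Y Z +
      f₅₁ x • S.R51 x X Y Z + f₅₂ x • S.R52 x X Y Z + f₆ x • S.R6 x X Y Z

end AlmostContactMetric

end Contact

/-! ### Submanifolds -/

section Submanifold

variable {n k : ℕ} {M : Type*} [TopologicalSpace M] [ChartedSpace (Eu n) M]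
  [IsManifold (𝓡 n) ∞ M] {N : Type*} [TopologicalSpace N] [ChartedSpace (Eu k) N]
  [IsManifold (𝓡 k) ∞ N]

/-- `F` is a smooth isometric immersion, so that `M` is a submanifold with the induced metric. -/
structure IsIsometricImmersion (g : Metric n M) (g' : Metric k N) (F : M → N) : Prop where
  smooth : ContMDiff (𝓡 n) (𝓡 k) ∞ F
  isometric : ∀ (p : M) (u v : TangentSpace (𝓡 n) p),
    g'.inner (F p) (mfderiv (𝓡 n) (𝓡 k) F p u) (mfderiv (𝓡 n) (𝓡 k) F p v) = g.inner p u v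

/-- The second fundamental form `σ(u, v) = ∇'_u v - ∇_u v` at `p`. -/
def secondForm (g : Metric n M) (g' : Metric k N) (F : M → N) (p : M)
    (u v : TangentSpace (𝓡 n) p) : TangentSpace (𝓡 k) (F p) :=
  coordSecondForm (E := Eu n) (E' := Eu k) (christoffel (metricInChart g p))
    (christoffel (metricInChart g' (F p))) (writtenInExtChartAt (𝓡 n) (𝓡 k) p F)
    (extChartAt (𝓡 n) p p) u v

set_option maxSynthPendingDepth 4 in
theorem coordSecondForm_bilinear {E E' : Type*} [NormedAddCommGroup E] [NormedSpace ℝ E]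
    [NormedAddCommGroup E'] [NormedSpace ℝ E'] (Γ : E → E →L[ℝ] E →L[ℝ] E)
    (Γ' : E' → E' →L[ℝ] E' →L[ℝ] E') (F : E → E') (y : E) :
    ∃ B : E →ₗ[ℝ] E →ₗ[ℝ] E', ∀ u v, coordSecondForm Γ Γ' F y u v = B u v := by
  refine ⟨LinearMap.mk₂ ℝ (coordSecondForm Γ Γ' F y) ?_ ?_ ?_ ?_, fun u v => rfl⟩ <;>
    intros <;>
    simp only [coordSecondForm, map_add, map_smul, add_apply, smul_apply, smul_add, smul_sub] <;>
    abel

/-- The mean curvature vector `H = (tr σ) / n`. -/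
def meanCurvature (g : Metric n M) (g' : Metric k N) (F : M → N) (p : M) :
    TangentSpace (𝓡 k) (F p) :=
  (n : ℝ)⁻¹ • metricTrace g p (secondForm g g' F p)

theorem meanCurvature_eq_sum {g : Metric n M} {p : M} {e : Fin n → TangentSpace (𝓡 n) p}
    (he : IsOrthonormalFrame g p e) (g' : Metric k N) (F : M → N) :
    meanCurvature g g' F p = (n : ℝ)⁻¹ • ∑ i, secondForm g g' F p (e i) (e i) := by
  obtain ⟨B, hB⟩ : ∃ B : TangentSpace (𝓡 n) p →ₗ[ℝ] TangentSpace (𝓡 n) p →ₗ[ℝ]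
      TangentSpace (𝓡 k) (F p), ∀ u v, secondForm g g' F p u v = B u v :=
    coordSecondForm_bilinear (E := Eu n) (E' := Eu k) _ _ _ _
  have h : secondForm g g' F p = fun u v => B u v := by
    funext u v
    exact hB u v
  rw [meanCurvature, h, metricTrace_eq_sum he B]

/-- The relative null space at `p`. -/
def relativeNullSpace (g : Metric n M) (g' : Metric k N) (F : M → N) (p : M) :
    Set (TangentSpace (𝓡 n) p) :=
  {X | ∀ Y, secondForm g g' F p X Y = 0}

/-- `p` is a totally geodesic point. -/
def IsTotallyGeodesicAt (g : Metric n M) (g' : Metric k N) (F : M → N) (p : M) : Prop :=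
  ∀ X Y, secondForm g g' F p X Y = 0

/-- `p` is a totally umbilical point. -/
def IsTotallyUmbilicalAt (g : Metric n M) (g' : Metric k N) (F : M → N) (p : M) : Prop :=
  ∀ X Y, secondForm g g' F p X Y = g.inner p X Y • meanCurvature g g' F p

/-- The tangential part of a vector `X` at `F p`, as a tangent vector of `M` at `p`: the vector `V`
such that `g(V, W) = g'(X, dF W)` for all `W`. -/
def tangentialPart (g : Metric n M) (g' : Metric k N) (F : M → N) (p : M)
    (X : TangentSpace (𝓡 k) (F p)) : TangentSpace (𝓡 n) p :=
  (g.inner p).inverse ((g'.inner (F p) X).comp (mfderiv (𝓡 n) (𝓡 k) F p))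

/-- The endomorphism `A^T` of the tangent space of `M` at `p`, where `A^T U` is the tangential part
of `A U`. -/
def tangentialEnd (g : Metric n M) (g' : Metric k N) (F : M → N) (p : M)
    (A : TangentSpace (𝓡 k) (F p) →L[ℝ] TangentSpace (𝓡 k) (F p)) :
    TangentSpace (𝓡 n) p →ₗ[ℝ] TangentSpace (𝓡 n) p where
  toFun U := tangentialPart g g' F p (A (mfderiv (𝓡 n) (𝓡 k) F p U))
  map_add' U V := by
    simp only [tangentialPart, map_add, ContinuousLinearMap.add_comp]
  map_smul' c U := by
    simp only [tangentialPart, map_smul, ContinuousLinearMap.smul_comp, RingHom.id_apply]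

end Submanifold

section TotallyReal

variable {m n : ℕ} {N : Type*} [TopologicalSpace N] [ChartedSpace (Eu (2 * m + 1)) N]
  [IsManifold (𝓡 (2 * m + 1)) ∞ N] {M : Type*} [TopologicalSpace M] [ChartedSpace (Eu n) M]
  [IsManifold (𝓡 n) ∞ M]

/-- Every tangent vector of the submanifold belongs to the contact distribution `η = 0`. -/
def IsCTotallyReal (S : AlmostContactMetric m N) (F : M → N) : Prop :=
  ∀ (p : M) (u : TangentSpace (𝓡 n) p), S.η (F p) (mfderiv (𝓡 n) (𝓡 (2 * m + 1)) F p u) = 0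

/-- The tangential part `h^T`. -/
def hT (S : AlmostContactMetric m N) (g : Metric n M) (F : M → N) (p : M) :
    TangentSpace (𝓡 n) p →ₗ[ℝ] TangentSpace (𝓡 n) p :=
  tangentialEnd g S.g F p (S.h (F p))

/-- The tangential part `(φ h)^T`. -/
def phihT (S : AlmostContactMetric m N) (g : Metric n M) (F : M → N) (p : M) :
    TangentSpace (𝓡 n) p →ₗ[ℝ] TangentSpace (𝓡 n) p :=
  tangentialEnd g S.g F p ((S.φ (F p)).comp (S.h (F p)))

/-- The upper bound for the Ricci curvature in the direction `U`. -/
def ricciBound (S : AlmostContactMetric m N) (f₁ f₄ f₅₁ f₅₂ : N → ℝ) (g : Metric n M) (F : M → N)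
    (p : M) (U : TangentSpace (𝓡 n) p) : ℝ :=
  1 / 4 * (n : ℝ) ^ 2 *
      S.g.inner (F p) (meanCurvature g S.g F p) (meanCurvature g S.g F p) +
    ((n : ℝ) - 1) * f₁ (F p) +
    f₄ (F p) * (LinearMap.trace ℝ (TangentSpace (𝓡 n) p) (hT S g F p) +
      ((n : ℝ) - 2) * g.inner p (hT S g F p U) U) +
    f₅₁ (F p) * (LinearMap.trace ℝ (TangentSpace (𝓡 n) p) (hT S g F p) *
      g.inner p (hT S g F p U) U - g.inner p (hT S g F p U) (hT S g F p U)) +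
    f₅₂ (F p) * (LinearMap.trace ℝ (TangentSpace (𝓡 n) p) (phihT S g F p) *
      g.inner p (phihT S g F p U) U - g.inner p (phihT S g F p U) (phihT S g F p U))

end TotallyReal

end KappaMu

end

/-! By the Gauss equation, for an orthonormal basis `e` containing `U`, Ric(U) is an ambient sum Σ_j
⟨R̃(e_j, U)U, e_j⟩ plus Σ_j (⟨σ(U,U), σ(e_j,e_j)⟩ - |σ(U,e_j)|²).

The ambient sum is explicit. As η vanishes on M, so does the pull-back of dη, and the contact
condition gives ⟨X, φY⟩ = 0 for tangent X, Y (`inner_phi_eq_zero`); this kills R₂, R₃ and R₆. In the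
remaining terms h and φh enter as symmetric operators (`h_symm`, `phi_h_symm`), and summing over the
basis produces the traces and squared norms in the bound. The symmetry of h comes from L_ξ η = 0,
hence L_ξ dη = 0: differentiating dη = ⟨·, φ·⟩ along ξ expresses L_ξ φ through the symmetric form
L_ξ g.

In the extrinsic sum Σ_j σ(e_j,e_j) = nH, and completing the square leaves Ric(U) = bound - |(n/2)H
- σ(U,U)|² - Σ_{e_j ≠ U} |σ(U,e_j)|², which is `ricci_eq_bound_sub`. The inequality follows, with
equality exactly when σ(U,U) = (n/2)H and σ(U,V) = 0 for all V ⊥ U. If H = 0 this says σ(U,·) = 0.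
If it holds for every unit U, summing over a basis gives nH = n(n/2)H, so H = 0 or n = 2.

The differential identities are proved for fields on a vector space near a point and carried to the
manifolds at the centre of the preferred chart, where the coordinate frame is the identity. -/

noncomputable section

set_option linter.unusedSectionVars false

namespace KappaMu

/-! ### Contact metric structures in coordinates and the symmetry of L_ξ φ. -/

section CoordinateCalculus

variable {E E' : Type*} [NormedAddCommGroup E] [NormedSpace ℝ E]
  [NormedAddCommGroup E'] [NormedSpace ℝ E']

/-- The exterior derivative of a 1-form commutes with pull-back. -/
theorem fderiv_pullback_antisymm {α : E' → E' →L[ℝ] ℝ} {β : E → E →L[ℝ] ℝ} {c : E → E'} {y : E}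
    (hα : DifferentiableAt ℝ α (c y)) (hc : ContDiffAt ℝ ∞ c y)
    (hβ : ∀ᶠ z in 𝓝 y, β z = (α (c z)).comp (fderiv ℝ c z)) (u v : E) :
    fderiv ℝ β y u v - fderiv ℝ β y v u =
      fderiv ℝ α (c y) (fderiv ℝ c y u) (fderiv ℝ c y v) -
        fderiv ℝ α (c y) (fderiv ℝ c y v) (fderiv ℝ c y u) := by
  have hc1 : DifferentiableAt ℝ c y := hc.differentiableAt (by simp)
  have hc2 : DifferentiableAt ℝ (fderiv ℝ c) y :=
    (hc.fderiv_right (m := 1) (by norm_cast)).differentiableAt (by simp)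
  have h : HasFDerivAt β _ y :=
    ((hα.hasFDerivAt.comp y hc1.hasFDerivAt).clm_comp hc2.hasFDerivAt).congr_of_eventuallyEq hβ
  -- The product rule also yields terms α(D²c(u, v)); they are symmetric in u, v and cancel in the
  -- difference.
  have hs : fderiv ℝ (fderiv ℝ c) y u v = fderiv ℝ (fderiv ℝ c) y v u :=
    (hc.isSymmSndFDerivAt (by simp; norm_cast)).eq u v
  rw [h.fderiv]
  simp [hs]

set_option maxSynthPendingDepth 4 in
/-- A bilinear form depending on a point, evaluated on two fields. -/
theorem hasFDerivAt_apply_apply {G : E → E' →L[ℝ] E' →L[ℝ] ℝ} {X Y : E → E'} {y : E}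
    {DG : E →L[ℝ] E' →L[ℝ] E' →L[ℝ] ℝ} {DX DY : E →L[ℝ] E'}
    (hG : HasFDerivAt G DG y) (hX : HasFDerivAt X DX y) (hY : HasFDerivAt Y DY y) (w : E) :
    fderiv ℝ (fun z => G z (X z) (Y z)) y w =
      DG w (X y) (Y y) + G y (DX w) (Y y) + G y (X y) (DY w) := by
  have h : HasFDerivAt (fun z => G z (X z) (Y z)) _ y := (hG.clm_apply hX).clm_apply hY
  rw [h.fderiv]
  simp
  ring

set_option maxSynthPendingDepth 4 in
theorem fderiv_symm_of_eventually {G : E → E' →L[ℝ] E' →L[ℝ] ℝ} {y : E}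
    (hG : DifferentiableAt ℝ G y) (hs : ∀ᶠ z in 𝓝 y, ∀ u v, G z u v = G z v u) (w : E) (u v : E') :
    fderiv ℝ G y w u v = fderiv ℝ G y w v u := by
  have h : (fun z => G z u v) =ᶠ[𝓝 y] fun z => G z v u := hs.mono fun z hz => hz u v
  have h1 := hasFDerivAt_apply_apply hG.hasFDerivAt (hasFDerivAt_const u y)
    (hasFDerivAt_const v y) w
  have h2 := hasFDerivAt_apply_apply hG.hasFDerivAt (hasFDerivAt_const v y)
    (hasFDerivAt_const u y) w
  rw [h.fderiv_eq] at h1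
  simpa [h2] using h1.symm

/-- A contact metric structure on an open part of a vector space, near a point. -/
structure IsContactNear (G : E → E →L[ℝ] E →L[ℝ] ℝ) (φ : E → E →L[ℝ] E) (ξ : E → E)
    (η : E → E →L[ℝ] ℝ) (y : E) : Prop where
  smooth_G : ContDiffAt ℝ ∞ G y
  smooth_φ : ContDiffAt ℝ ∞ φ y
  smooth_ξ : ContDiffAt ℝ ∞ ξ y
  smooth_η : ContDiffAt ℝ ∞ η y
  symm : ∀ᶠ z in 𝓝 y, ∀ u v, G z u v = G z v u
  φ_φ : ∀ᶠ z in 𝓝 y, ∀ u, φ z (φ z u) = -u + η z u • ξ z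
  η_ξ : ∀ᶠ z in 𝓝 y, η z (ξ z) = 1
  φ_ξ : ∀ᶠ z in 𝓝 y, φ z (ξ z) = 0
  η_φ : ∀ᶠ z in 𝓝 y, ∀ u, η z (φ z u) = 0
  skew : ∀ᶠ z in 𝓝 y, ∀ u v, G z u (φ z v) = -G z (φ z u) v
  inner_ξ : ∀ᶠ z in 𝓝 y, ∀ u, G z u (ξ z) = η z u
  contact : ∀ᶠ z in 𝓝 y, ∀ u v, 2⁻¹ * (fderiv ℝ η z u v - fderiv ℝ η z v u) = G z u (φ z v)

namespace IsContactNear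

variable {G : E → E →L[ℝ] E →L[ℝ] ℝ} {φ : E → E →L[ℝ] E} {ξ : E → E} {η : E → E →L[ℝ] ℝ} {y : E}

/-- `L_ξ η = 0`. -/
theorem lieDeriv_form (S : IsContactNear G φ ξ η y) :
    ∀ᶠ z in 𝓝 y, ∀ u, fderiv ℝ η z (ξ z) u + η z (fderiv ℝ ξ z u) = 0 := by
  have hξ := (S.smooth_ξ.of_le (m := 1) (by norm_cast)).eventually (by simp)
  have hη := (S.smooth_η.of_le (m := 1) (by norm_cast)).eventually (by simp)
  filter_upwards [hξ, hη, S.η_ξ.eventually_nhds, S.contact, S.φ_ξ, S.skew] with z h1 h2 h3 h4 h5 h6 u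
  have hd : HasFDerivAt (fun z => η z (ξ z)) _ z :=
    (h2.differentiableAt (by simp)).hasFDerivAt.clm_apply
      (h1.differentiableAt (by simp)).hasFDerivAt
  have h0 : fderiv ℝ (fun z => η z (ξ z)) z = 0 := by
    have : (fun z => η z (ξ z)) =ᶠ[𝓝 z] fun _ => 1 := h3
    rw [this.fderiv_eq]
    simp
  -- Cartan's formula L_ξ η = d(η(ξ)) + 2 ι_ξ dη in the present normalization: `h7` says that the
  -- derivative of η(ξ) = 1 vanishes, `h8` that dη(ξ, ·) = ⟨ξ, φ·⟩ = 0.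
  have h7 := congrArg (fun T => T u) (hd.fderiv.symm.trans h0)
  have h8 := h4 (ξ z) u
  rw [h6, h5] at h8
  simp at h7 h8
  linarith

/-- `L_ξ dη = 0`. -/
theorem lieDeriv_extDeriv (S : IsContactNear G φ ξ η y) (u v : E) :
    fderiv ℝ (fderiv ℝ η) y (ξ y) u v - fderiv ℝ (fderiv ℝ η) y (ξ y) v u +
      (fderiv ℝ η y (fderiv ℝ ξ y u) v - fderiv ℝ η y v (fderiv ℝ ξ y u)) +
      (fderiv ℝ η y u (fderiv ℝ ξ y v) - fderiv ℝ η y (fderiv ℝ ξ y v) u) = 0 := by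
  have hη := (S.smooth_η.differentiableAt (by simp)).hasFDerivAt
  have hξ := (S.smooth_ξ.differentiableAt (by simp)).hasFDerivAt
  have hη2 := ((S.smooth_η.fderiv_right (m := 1)
    (by norm_cast)).differentiableAt (by simp)).hasFDerivAt
  have hξ2 := ((S.smooth_ξ.fderiv_right (m := 1)
    (by norm_cast)).differentiableAt (by simp)).hasFDerivAt
  -- The equation (L_ξ η)(a) = 0 differentiated in the direction b. Antisymmetrizing in a, b turns
  -- it into d(L_ξ η) = L_ξ(dη), up to the factor 2, as the second derivatives of ξ cancel.
  have key : ∀ a b : E, fderiv ℝ (fderiv ℝ η) y b (ξ y) a + fderiv ℝ η y (fderiv ℝ ξ y b) a +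
      fderiv ℝ η y b (fderiv ℝ ξ y a) + η y (fderiv ℝ (fderiv ℝ ξ) y b a) = 0 := by
    intro a b
    have hd : HasFDerivAt (fun z => fderiv ℝ η z (ξ z) a + η z (fderiv ℝ ξ z a)) _ y :=
      ((hη2.clm_apply hξ).clm_apply (hasFDerivAt_const a y)).add
        (hη.clm_apply (hξ2.clm_apply (hasFDerivAt_const a y)))
    have h0 : (fun z => fderiv ℝ η z (ξ z) a + η z (fderiv ℝ ξ z a)) =ᶠ[𝓝 y] fun _ => 0 :=
      S.lieDeriv_form.mono fun z hz => hz a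
    have := congrArg (fun T => T b) (hd.fderiv.symm.trans h0.fderiv_eq)
    simp at this
    linarith
  have s1 := (S.smooth_η.isSymmSndFDerivAt (by simp; norm_cast)).eq (ξ y)
  have s2 := (S.smooth_ξ.isSymmSndFDerivAt (by simp; norm_cast)).eq u v
  have k1 := key u v
  have k2 := key v u
  rw [s1 u, s1 v]
  rw [s2] at k2
  linarith

set_option maxSynthPendingDepth 4 in
/-- `g(X, (L_ξ φ) Y) = -(L_ξ g)(X, φ Y)`. -/
theorem inner_lieDeriv (S : IsContactNear G φ ξ η y) (u v : E) :
    G y u (coordLieDerivEnd ξ φ y v) =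
      -(fderiv ℝ G y (ξ y) u (φ y v) + G y (fderiv ℝ ξ y u) (φ y v) +
        G y u (fderiv ℝ ξ y (φ y v))) := by
  have hG := (S.smooth_G.differentiableAt (by simp)).hasFDerivAt
  have hφ := (S.smooth_φ.differentiableAt (by simp)).hasFDerivAt
  have hη2 := ((S.smooth_η.fderiv_right (m := 1)
    (by norm_cast)).differentiableAt (by simp)).hasFDerivAt
  have hd : HasFDerivAt (fun z => 2⁻¹ * (fderiv ℝ η z u v - fderiv ℝ η z v u)) _ y :=
    ((((hη2.clm_apply (hasFDerivAt_const u y)).clm_apply (hasFDerivAt_const v y))).sub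
      (((hη2.clm_apply (hasFDerivAt_const v y)).clm_apply (hasFDerivAt_const u y)))).const_mul _
  have h0 : (fun z => 2⁻¹ * (fderiv ℝ η z u v - fderiv ℝ η z v u)) =ᶠ[𝓝 y]
      fun z => G z u (φ z v) := S.contact.mono fun z hz => hz u v
  -- The contact equation is differentiated along ξ with constant u, v; `h4` and `h5` supply the
  -- terms in which Dξ acts on an argument. The η side then adds up to L_ξ dη = 0, and the other
  -- side is the Leibniz rule for L_ξ of g(·, φ·).
  have h1 := congrArg (fun T => T (ξ y)) (hd.fderiv.symm.trans h0.fderiv_eq)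
  have h2 := hasFDerivAt_apply_apply hG (hasFDerivAt_const u y)
    (hφ.clm_apply (hasFDerivAt_const v y)) (ξ y)
  have h3 := S.lieDeriv_extDeriv u v
  have h4 := S.contact.self_of_nhds (fderiv ℝ ξ y u) v
  have h5 := S.contact.self_of_nhds u (fderiv ℝ ξ y v)
  simp only [h2] at h1
  simp at h1
  simp only [coordLieDerivEnd, add_apply, sub_apply, ContinuousLinearMap.comp_apply,
    map_add, map_sub]
  linarith

/-- `h φ + φ h = 0`, where `2 h = L_ξ φ`. -/
theorem lieDeriv_anticomm (S : IsContactNear G φ ξ η y) (u : E) :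
    coordLieDerivEnd ξ φ y (φ y u) = -φ y (coordLieDerivEnd ξ φ y u) := by
  have hφ := (S.smooth_φ.differentiableAt (by simp)).hasFDerivAt
  have hη := (S.smooth_η.differentiableAt (by simp)).hasFDerivAt
  have hξ := (S.smooth_ξ.differentiableAt (by simp)).hasFDerivAt
  have h1 : HasFDerivAt (fun z => φ z (φ z u)) _ y :=
    hφ.clm_apply (hφ.clm_apply (hasFDerivAt_const u y))
  have h2 : HasFDerivAt (fun z => -u + η z u • ξ z) _ y :=
    (hasFDerivAt_const (-u) y).add ((hη.clm_apply (hasFDerivAt_const u y)).smul hξ)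
  have h0 : (fun z => φ z (φ z u)) =ᶠ[𝓝 y] fun z => -u + η z u • ξ z :=
    S.φ_φ.mono fun z hz => hz u
  -- This is L_ξ applied to φ² = -I + η ⊗ ξ; the right side contributes nothing because L_ξ η = 0
  -- and [ξ, ξ] = 0.
  have h3 := congrArg (fun T => T (ξ y)) ((h1.fderiv.symm.trans h0.fderiv_eq).trans h2.fderiv)
  have h4 := S.φ_φ.self_of_nhds
  have h5 := S.lieDeriv_form.self_of_nhds u
  simp at h3
  rw [eq_neg_iff_add_eq_zero]
  simp only [coordLieDerivEnd, add_apply, sub_apply, ContinuousLinearMap.comp_apply,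
    map_add, map_sub, h4]
  have h6 : fderiv ℝ η y (ξ y) u = - η y (fderiv ℝ ξ y u) := by linarith
  rw [h6] at h3
  rw [add_comm] at h3
  simp only [map_neg, map_smul]
  linear_combination (norm := module) h3

/-- Apply L_ξ to η ∘ φ = 0 and use L_ξ η = 0. -/
theorem form_lieDeriv (S : IsContactNear G φ ξ η y) (u : E) :
    η y (coordLieDerivEnd ξ φ y u) = 0 := by
  have hφ := (S.smooth_φ.differentiableAt (by simp)).hasFDerivAt
  have hη := (S.smooth_η.differentiableAt (by simp)).hasFDerivAt
  have h1 : HasFDerivAt (fun z => η z (φ z u)) _ y :=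
    hη.clm_apply (hφ.clm_apply (hasFDerivAt_const u y))
  have h0 : (fun z => η z (φ z u)) =ᶠ[𝓝 y] fun z => 0 :=
    S.η_φ.mono fun z hz => hz u
  have h3 := congrArg (fun T => T (ξ y)) (h1.fderiv.symm.trans h0.fderiv_eq)
  have h5 := S.lieDeriv_form.self_of_nhds (φ y u)
  have h6 := S.η_φ.self_of_nhds (fderiv ℝ ξ y u)
  simp at h3
  simp only [coordLieDerivEnd, add_apply, sub_apply, ContinuousLinearMap.comp_apply,
    map_add, map_sub, h6]
  linarith

/-- `L_ξ φ` is symmetric. -/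
theorem lieDeriv_symm (S : IsContactNear G φ ξ η y) (u v : E) :
    G y (coordLieDerivEnd ξ φ y u) v = G y u (coordLieDerivEnd ξ φ y v) := by
  have hs := S.symm.self_of_nhds
  have hsd := fderiv_symm_of_eventually (S.smooth_G.differentiableAt (by simp)) S.symm (ξ y)
  -- With φa in the first slot, `inner_lieDeriv` becomes -(L_ξ g)(φa, φb), which is symmetric in a,
  -- b. Taking a = φu and moving φ across by skewness and anticommutation leaves φ² on both sides;
  -- its ξ-component drops out since η ∘ L_ξ φ = 0.
  have hsw : ∀ a b, G y (φ y a) (coordLieDerivEnd ξ φ y b) =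
      G y (φ y b) (coordLieDerivEnd ξ φ y a) := by
    intro a b
    rw [S.inner_lieDeriv, S.inner_lieDeriv, hsd, hs _ (φ y b), hs (φ y a)]
    ring
  have h1 := hsw (φ y u) v
  rw [S.lieDeriv_anticomm, map_neg, S.skew.self_of_nhds, S.φ_φ.self_of_nhds,
    S.φ_φ.self_of_nhds] at h1
  have h2 : ∀ a, G y (ξ y) (coordLieDerivEnd ξ φ y a) = 0 := fun a => by
    rw [hs, S.inner_ξ.self_of_nhds, S.form_lieDeriv]
  simp [h2] at h1
  rw [hs, h1]

end IsContactNear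

end CoordinateCalculus

/-! ### Levi-Civita connection, second fundamental form and Gauss equation in coordinates. -/

section GaussEquation

variable {E E' : Type*} [NormedAddCommGroup E] [NormedSpace ℝ E] [FiniteDimensional ℝ E]
  [NormedAddCommGroup E'] [NormedSpace ℝ E'] [FiniteDimensional ℝ E']

theorem isInvertible_of_pos {B : E →L[ℝ] E →L[ℝ] ℝ} (hB : ∀ v, v ≠ 0 → 0 < B v v) :
    B.IsInvertible := by
  let T : E →ₗ[ℝ] (E →L[ℝ] ℝ) := B
  have hT : Function.Injective T := by
    rw [← LinearMap.ker_eq_bot, LinearMap.ker_eq_bot']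
    intro v hv
    by_contra h
    have h1 := hB v h
    have h2 : B v v = 0 := congrArg (fun α : E →L[ℝ] ℝ => α v) hv
    linarith
  have hfin : Module.finrank ℝ E = Module.finrank ℝ (E →L[ℝ] ℝ) := by
    rw [← Subspace.dual_finrank_eq]
    exact LinearEquiv.finrank_eq LinearMap.toContinuousLinearMap
  exact ⟨(LinearMap.linearEquivOfInjective T hT hfin).toContinuousLinearEquiv, by ext; rfl⟩

theorem apply_inverse_of_pos {B : E →L[ℝ] E →L[ℝ] ℝ} (hB : ∀ v, v ≠ 0 → 0 < B v v)
    (α : E →L[ℝ] ℝ) : B (B.inverse α) = α := by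
  obtain ⟨T, rfl⟩ := isInvertible_of_pos hB
  simp

/-- A Riemannian metric on an open part of a vector space, near a point. -/
structure IsMetricNear (G : E → E →L[ℝ] E →L[ℝ] ℝ) (y : E) : Prop where
  smooth : ContDiffAt ℝ 2 G y
  symm : ∀ᶠ z in 𝓝 y, ∀ u v, G z u v = G z v u
  pos : ∀ᶠ z in 𝓝 y, ∀ v, v ≠ 0 → 0 < G z v v

namespace IsMetricNear

variable {G : E → E →L[ℝ] E →L[ℝ] ℝ} {y : E}

theorem inner_christoffel (hG : IsMetricNear G y) (u v w : E) :
    G y (christoffel G y u v) w = christoffelFirst G y u v w := by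
  rw [christoffel_apply, apply_inverse_of_pos hG.pos.self_of_nhds]

set_option maxSynthPendingDepth 4 in
theorem eventually (hG : IsMetricNear G y) : ∀ᶠ z in 𝓝 y, IsMetricNear G z := by
  filter_upwards [hG.smooth.eventually (by simp), hG.symm.eventually_nhds,
    hG.pos.eventually_nhds] with z h1 h2 h3
  exact ⟨h1, h2, h3⟩

theorem christoffel_symm (hG : IsMetricNear G y) (u v : E) :
    christoffel G y u v = christoffel G y v u := by
  rw [christoffel_apply, christoffel_apply]
  congr 1
  ext w
  rw [christoffelFirst_apply, christoffelFirst_apply,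
    fderiv_symm_of_eventually (hG.smooth.differentiableAt (by simp)) hG.symm w u v]
  ring

/-- This is ∇G = 0: in the sum of two Christoffel symbols of the first kind all derivatives of G but
one cancel by symmetry. -/
theorem fderiv_eq_christoffel (hG : IsMetricNear G y) (u v w : E) :
    fderiv ℝ G y u v w = G y (christoffel G y u v) w + G y v (christoffel G y u w) := by
  have hs := fderiv_symm_of_eventually (hG.smooth.differentiableAt (by simp)) hG.symm
  rw [hG.symm.self_of_nhds v, hG.inner_christoffel, hG.inner_christoffel, christoffelFirst_apply,
    christoffelFirst_apply, hs w u v, hs v u w, hs u w v]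
  ring

set_option maxSynthPendingDepth 4 in
theorem differentiableAt_christoffel (hG : IsMetricNear G y) :
    DifferentiableAt ℝ (christoffel G) y := by
  have hD : DifferentiableAt ℝ (fderiv ℝ G) y :=
    (hG.smooth.fderiv_right (m := 1) (by norm_num)).differentiableAt (by simp)
  have hf : ∀ {A B C : Type _} [NormedAddCommGroup A] [NormedSpace ℝ A] [NormedAddCommGroup B]
      [NormedSpace ℝ B] [NormedAddCommGroup C] [NormedSpace ℝ C] {T : E → A →L[ℝ] B →L[ℝ] C},
      DifferentiableAt ℝ T y → DifferentiableAt ℝ (fun z => (T z).flip) y := by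
    intro A B C _ _ _ _ _ _ T hT
    exact ((ContinuousLinearMap.flipₗᵢ ℝ A B C).toContinuousLinearEquiv.toContinuousLinearMap
      ).differentiableAt.comp y hT
  have h1 : DifferentiableAt ℝ (christoffelFirst G) y :=
    ((hD.add (hf hD)).sub ((differentiableAt_const _).clm_comp (hf hD))).const_smul (2⁻¹ : ℝ)
  have h2 : DifferentiableAt ℝ (fun z => (G z).inverse) y := by
    obtain ⟨T, hT⟩ := isInvertible_of_pos hG.pos.self_of_nhds
    have := contDiffAt_map_inverse (n := 1) T
    rw [hT] at this
    exact (this.differentiableAt (by simp)).comp y (hG.smooth.differentiableAt (by simp))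
  exact ((ContinuousLinearMap.compL ℝ E (E →L[ℝ] ℝ) E).differentiableAt.comp y h2).clm_comp h1

end IsMetricNear

/-- An isometric immersion of an open part of a vector space into another, near a point. -/
structure IsIsometricNear (G : E → E →L[ℝ] E →L[ℝ] ℝ) (G' : E' → E' →L[ℝ] E' →L[ℝ] ℝ)
    (F : E → E') (y : E) : Prop where
  metric : IsMetricNear G y
  metric' : IsMetricNear G' (F y)
  smooth : ContDiffAt ℝ 3 F y
  isometric : ∀ᶠ z in 𝓝 y, ∀ u v, G' (F z) (fderiv ℝ F z u) (fderiv ℝ F z v) = G z u v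

namespace IsIsometricNear

variable {G : E → E →L[ℝ] E →L[ℝ] ℝ} {G' : E' → E' →L[ℝ] E' →L[ℝ] ℝ} {F : E → E'} {y : E}

/-- Openness of the condition allows identities proved at a point, such as the normality of σ, to be
differentiated. -/
theorem eventually (h : IsIsometricNear G G' F y) : ∀ᶠ z in 𝓝 y, IsIsometricNear G G' F z := by
  filter_upwards [h.metric.eventually, h.smooth.continuousAt.eventually h.metric'.eventually,
    h.smooth.eventually (by simp), h.isometric.eventually_nhds] with z h1 h2 h3 h4
  exact ⟨h1, h2, h3, h4⟩

theorem hasFDerivAt_fderiv (h : IsIsometricNear G G' F y) :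
    HasFDerivAt (fderiv ℝ F) (fderiv ℝ (fderiv ℝ F) y) y :=
  ((h.smooth.fderiv_right (m := 2) (by norm_num)).differentiableAt (by simp)).hasFDerivAt

theorem hasFDerivAt (h : IsIsometricNear G G' F y) : HasFDerivAt F (fderiv ℝ F y) y :=
  (h.smooth.differentiableAt (by simp)).hasFDerivAt

theorem symmSnd (h : IsIsometricNear G G' F y) (u v : E) :
    fderiv ℝ (fderiv ℝ F) y u v = fderiv ℝ (fderiv ℝ F) y v u :=
  (h.smooth.isSymmSndFDerivAt (by simp; norm_cast)).eq u v

set_option maxSynthPendingDepth 4 in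
/-- The derivative of `G'(X, Y)` for vector fields along `F`. -/
theorem fderiv_inner_along (h : IsIsometricNear G G' F y) {X Y : E → E'} {DX DY : E →L[ℝ] E'}
    (hX : HasFDerivAt X DX y) (hY : HasFDerivAt Y DY y) (u : E) :
    fderiv ℝ (fun z => G' (F z) (X z) (Y z)) y u =
      G' (F y) (DX u + christoffel G' (F y) (fderiv ℝ F y u) (X y)) (Y y) +
      G' (F y) (X y) (DY u + christoffel G' (F y) (fderiv ℝ F y u) (Y y)) := by
  have hG' := (h.metric'.smooth.differentiableAt (by simp)).hasFDerivAt.comp y h.hasFDerivAt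
  have h1 := hasFDerivAt_apply_apply (G := fun z => G' (F z)) hG' hX hY u
  rw [h1, ContinuousLinearMap.comp_apply, h.metric'.fderiv_eq_christoffel]
  simp only [map_add, add_apply]
  ring

theorem secondForm_symm (h : IsIsometricNear G G' F y) (u v : E) :
    coordSecondForm (christoffel G) (christoffel G') F y u v =
      coordSecondForm (christoffel G) (christoffel G') F y v u := by
  simp only [coordSecondForm]
  rw [h.symmSnd, h.metric.christoffel_symm, h.metric'.christoffel_symm]

/-- The second fundamental form takes values in the normal space. -/
theorem secondForm_normal (h : IsIsometricNear G G' F y) (u v w : E) :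
    G' (F y) (coordSecondForm (christoffel G) (christoffel G') F y u v) (fderiv ℝ F y w) = 0 := by
  -- `A u v` is the ambient covariant derivative ∇'_u(dF v), symmetric in u, v. Differentiating the
  -- isometry condition gives `hD`.
  set A : E → E → E' := fun u v =>
    fderiv ℝ (fderiv ℝ F) y u v + christoffel G' (F y) (fderiv ℝ F y u) (fderiv ℝ F y v) with hA
  have hAs : ∀ u v, A u v = A v u := fun u v => by
    simp only [hA]
    rw [h.symmSnd, h.metric'.christoffel_symm]
  have hs := h.metric'.symm.self_of_nhds
  have hD : ∀ a b c, fderiv ℝ G y a b c =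
      G' (F y) (A a b) (fderiv ℝ F y c) + G' (F y) (fderiv ℝ F y b) (A a c) := by
    intro a b c
    have h1 := h.fderiv_inner_along (h.hasFDerivAt_fderiv.clm_apply (hasFDerivAt_const b y))
      (h.hasFDerivAt_fderiv.clm_apply (hasFDerivAt_const c y)) a
    have h2 : (fun z => G' (F z) (fderiv ℝ F z b) (fderiv ℝ F z c)) =ᶠ[𝓝 y]
        fun z => G z b c := h.isometric.mono fun z hz => hz b c
    have h3 := hasFDerivAt_apply_apply (h.metric.smooth.differentiableAt (by simp)).hasFDerivAt
      (hasFDerivAt_const b y) (hasFDerivAt_const c y) a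
    rw [h2.fderiv_eq, h3] at h1
    simpa [hA] using h1
  -- Koszul's argument: the combination of `hD` defining the Christoffel symbol isolates ⟨A(u, v),
  -- dF w⟩, so the tangential part of A(u, v) is dF(Γ(u, v)).
  have h4 : G' (F y) (A u v) (fderiv ℝ F y w) = christoffelFirst G y u v w := by
    rw [christoffelFirst_apply, hD, hD, hD, hAs v u, hAs w u, hAs w v, hs _ (A v w),
      hs _ (A u w)]
    ring
  have h5 := h.isometric.self_of_nhds (christoffel G y u v) w
  rw [h.metric.inner_christoffel, ← h4] at h5
  change G' (F y) (A u v - _) _ = 0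
  rw [map_sub, sub_apply, h5, sub_self]

set_option maxSynthPendingDepth 4 in
/-- The Gauss equation. -/
theorem gauss (h : IsIsometricNear G G' F y) (u v w z : E) :
    G y (coordCurvature (christoffel G) y u v w) z =
      G' (F y) (coordCurvature (christoffel G') (F y) (fderiv ℝ F y u) (fderiv ℝ F y v)
        (fderiv ℝ F y w)) (fderiv ℝ F y z) +
      G' (F y) (coordSecondForm (christoffel G) (christoffel G') F y v w)
        (coordSecondForm (christoffel G) (christoffel G') F y u z) -
      G' (F y) (coordSecondForm (christoffel G) (christoffel G') F y u w)
        (coordSecondForm (christoffel G) (christoffel G') F y v z) := by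
  have hF1 := h.hasFDerivAt
  have hF2 := h.hasFDerivAt_fderiv
  have hF3 : HasFDerivAt (fderiv ℝ (fderiv ℝ F)) (fderiv ℝ (fderiv ℝ (fderiv ℝ F)) y) y :=
    (((h.smooth.fderiv_right (m := 2) (by norm_num)).fderiv_right (m := 1)
      (by norm_num)).differentiableAt (by simp)).hasFDerivAt
  have hΓ := h.metric.differentiableAt_christoffel.hasFDerivAt
  have hΓ' := h.metric'.differentiableAt_christoffel.hasFDerivAt.comp y hF1
  have h3s : fderiv ℝ (fderiv ℝ (fderiv ℝ F)) y u v = fderiv ℝ (fderiv ℝ (fderiv ℝ F)) y v u :=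
    ((h.smooth.fderiv_right (m := 2) (by norm_num)).isSymmSndFDerivAt (by simp)).eq u v
  have hn := h.secondForm_normal
  have hs := h.metric'.symm.self_of_nhds
  set σ := coordSecondForm (christoffel G) (christoffel G') F with hσ
  have hσd : ∀ a b c : E, ∃ D : E →L[ℝ] E', HasFDerivAt (fun x => σ x b c) D y ∧
      D a = fderiv ℝ (fderiv ℝ (fderiv ℝ F)) y a b c +
        (fderiv ℝ (christoffel G') (F y) (fderiv ℝ F y a) (fderiv ℝ F y b) (fderiv ℝ F y c) +
        christoffel G' (F y) (fderiv ℝ (fderiv ℝ F) y a b) (fderiv ℝ F y c) +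
        christoffel G' (F y) (fderiv ℝ F y b) (fderiv ℝ (fderiv ℝ F) y a c)) -
        (fderiv ℝ (fderiv ℝ F) y a (christoffel G y b c) +
          fderiv ℝ F y (fderiv ℝ (christoffel G) y a b c)) := by
    intro a b c
    refine ⟨_, (((hF3.clm_apply (hasFDerivAt_const b y)).clm_apply (hasFDerivAt_const c y)).add
      ((hΓ'.clm_apply (hF2.clm_apply (hasFDerivAt_const b y))).clm_apply
        (hF2.clm_apply (hasFDerivAt_const c y)))).sub (hF2.clm_apply
          ((hΓ.clm_apply (hasFDerivAt_const b y)).clm_apply (hasFDerivAt_const c y))), ?_⟩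
    simp
    abel
  -- T is the covariant derivative ∇'_a(σ(b, w)) along F. Differentiating ⟨σ(b, w), dF z⟩ = 0 gives
  -- ⟨T, dF z⟩ = -⟨σ(b, w), ∇'_a dF z⟩, and only the normal part σ(a, z) of the last vector counts.
  have key : ∀ a b : E, ∃ T : E',
      T = fderiv ℝ (fderiv ℝ (fderiv ℝ F)) y a b w +
        (fderiv ℝ (christoffel G') (F y) (fderiv ℝ F y a) (fderiv ℝ F y b) (fderiv ℝ F y w) +
        christoffel G' (F y) (fderiv ℝ (fderiv ℝ F) y a b) (fderiv ℝ F y w) +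
        christoffel G' (F y) (fderiv ℝ F y b) (fderiv ℝ (fderiv ℝ F) y a w)) -
        (fderiv ℝ (fderiv ℝ F) y a (christoffel G y b w) +
          fderiv ℝ F y (fderiv ℝ (christoffel G) y a b w)) +
        christoffel G' (F y) (fderiv ℝ F y a) (σ y b w) ∧
      G' (F y) T (fderiv ℝ F y z) = -G' (F y) (σ y b w) (σ y a z) := by
    intro a b
    obtain ⟨D, hD, hDa⟩ := hσd a b w
    refine ⟨_, rfl, ?_⟩
    rw [← hDa]
    have h1 := h.fderiv_inner_along hD (hF2.clm_apply (hasFDerivAt_const z y)) a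
    have h2 : (fun x => G' (F x) (σ x b w) (fderiv ℝ F x z)) =ᶠ[𝓝 y] fun x => 0 :=
      h.eventually.mono fun x hx => hx.secondForm_normal b w z
    rw [h2.fderiv_eq] at h1
    have h3 : fderiv ℝ (fderiv ℝ F) y a z +
        christoffel G' (F y) (fderiv ℝ F y a) (fderiv ℝ F y z) =
        σ y a z + fderiv ℝ F y (christoffel G y a z) := by
      simp [hσ, coordSecondForm]
    simp only [ContinuousLinearMap.comp_zero, zero_add, map_add, add_apply,
      ContinuousLinearMap.flip_apply, h3, hn, fderiv_fun_const, Pi.zero_apply, zero_apply] at h1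
    simp only [map_add, add_apply]
    linarith
  obtain ⟨T₁, hT₁, h₁⟩ := key u v
  obtain ⟨T₂, hT₂, h₂⟩ := key v u
  -- Antisymmetrization removes the third derivatives of F and leaves the two curvatures; the
  -- remaining σ terms are normal and vanish against dF z.
  have hT : T₁ - T₂ = coordCurvature (christoffel G') (F y) (fderiv ℝ F y u) (fderiv ℝ F y v)
        (fderiv ℝ F y w) - fderiv ℝ F y (coordCurvature (christoffel G) y u v w) -
        σ y u (christoffel G y v w) + σ y v (christoffel G y u w) := by
    rw [hT₁, hT₂, h.symmSnd v u, h3s]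
    simp only [hσ, coordSecondForm, coordCurvature, map_add, map_sub]
    abel
  have h3 := congrArg (fun X => G' (F y) X (fderiv ℝ F y z)) hT
  simp only [map_sub, map_add, sub_apply, add_apply] at h3
  rw [hn, hn, h₁, h₂, h.isometric.self_of_nhds] at h3
  linarith

end IsIsometricNear

end GaussEquation

/-! ### Smoothness of tensor fields in the preferred chart. -/

section Charts

variable {d : ℕ} {M : Type*} [TopologicalSpace M] [ChartedSpace (Eu d) M] [IsManifold (𝓡 d) ∞ M]

theorem chartFrame_self (p : M) :
    (chartFrame p (extChartAt (𝓡 d) p p) : Eu d →L[ℝ] Eu d) = ContinuousLinearMap.id ℝ (Eu d) :=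
  mfderivWithin_range_extChartAt_symm

theorem symm_mem_chart_source {p : M} {y : Eu d} (hy : y ∈ (extChartAt (𝓡 d) p).target) :
    (extChartAt (𝓡 d) p).symm y ∈ (chartAt (Eu d) p).source := by
  rw [← extChartAt_source (𝓡 d)]
  exact (extChartAt (𝓡 d) p).map_target hy

/-- Smoothness of bundle sections is expressed through the trivialization at p; this identification
transfers it to the coordinate expressions. -/
theorem chartFrame_eq_symmL {p : M} {y : Eu d} (hy : y ∈ (extChartAt (𝓡 d) p).target) :
    (chartFrame p y : Eu d →L[ℝ] Eu d) =
      (trivializationAt (Eu d) (TangentSpace (𝓡 d)) p).symmL ℝ ((extChartAt (𝓡 d) p).symm y) := by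
  have h := TangentBundle.symmL_trivializationAt (I := 𝓡 d) (symm_mem_chart_source hy)
  -- The chart applied to its inverse at y equals y only propositionally, and the fibre depends on
  -- the point, so the equality is substituted in a general z.
  have key : ∀ z, z = y →
      (mfderivWithin 𝓘(ℝ, Eu d) (𝓡 d) (extChartAt (𝓡 d) p).symm (Set.range (𝓡 d)) z :
        Eu d →L[ℝ] Eu d) = chartFrame p y := by
    rintro _ rfl
    rfl
  exact (Eq.trans (b := (mfderivWithin 𝓘(ℝ, Eu d) (𝓡 d) (extChartAt (𝓡 d) p).symm
    (Set.range (𝓡 d)) (extChartAt (𝓡 d) p ((extChartAt (𝓡 d) p).symm y)) : Eu d →L[ℝ] Eu d))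
    h (key _ ((extChartAt (𝓡 d) p).right_inv hy))).symm

theorem chartFrame_isInvertible {p : M} {y : Eu d} (hy : y ∈ (extChartAt (𝓡 d) p).target) :
    (chartFrame p y).IsInvertible :=
  isInvertible_mfderivWithin_extChartAt_symm hy

theorem chartFrame_inverse_apply {p : M} {y : Eu d} (hy : y ∈ (extChartAt (𝓡 d) p).target)
    (u : Eu d) : (chartFrame p y).inverse (chartFrame p y u) = u :=
  (chartFrame_isInvertible hy).inverse_apply_self u

theorem chartFrame_apply_inverse {p : M} {y : Eu d} (hy : y ∈ (extChartAt (𝓡 d) p).target)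
    (u : TangentSpace (𝓡 d) ((extChartAt (𝓡 d) p).symm y)) :
    chartFrame p y ((chartFrame p y).inverse u) = u :=
  (chartFrame_isInvertible hy).self_apply_inverse u

theorem chartFrame_inverse_eq {p : M} {y : Eu d} (hy : y ∈ (extChartAt (𝓡 d) p).target) :
    ((chartFrame p y).inverse : Eu d →L[ℝ] Eu d) =
      (trivializationAt (Eu d) (TangentSpace (𝓡 d)) p).continuousLinearMapAt ℝ
        ((extChartAt (𝓡 d) p).symm y) := by
  have hb : (extChartAt (𝓡 d) p).symm y ∈
    (trivializationAt (Eu d) (TangentSpace (𝓡 d)) p).baseSet := by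
    simpa using symm_mem_chart_source hy
  ext1 v
  obtain ⟨u, rfl⟩ : ∃ u, v = chartFrame p y u := ⟨_, (chartFrame_apply_inverse hy v).symm⟩
  refine (chartFrame_inverse_apply hy u).trans ?_
  have h : (chartFrame p y u : Eu d) = _ :=
    congrArg (fun T : Eu d →L[ℝ] Eu d => T u) (chartFrame_eq_symmL hy)
  rw [h]
  exact (Trivialization.continuousLinearMapAt_symmL (R := ℝ) _ hb u).symm

theorem contDiffAt_of_eq_comp_symm {V : Type*} [NormedAddCommGroup V] [NormedSpace ℝ V] {p : M}
    {f : Eu d → V} {s : M → V} (hs : ContMDiffAt (𝓡 d) 𝓘(ℝ, V) ∞ s p)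
    (hf : ∀ y ∈ (extChartAt (𝓡 d) p).target, f y = s ((extChartAt (𝓡 d) p).symm y)) :
    ContDiffAt ℝ ∞ f (extChartAt (𝓡 d) p p) := by
  rw [← contMDiffAt_iff_contDiffAt]
  have h1 : ContMDiffAt 𝓘(ℝ, Eu d) (𝓡 d) ∞ (extChartAt (𝓡 d) p).symm (extChartAt (𝓡 d) p p) :=
    (contMDiffOn_extChartAt_symm p).contMDiffAt (extChartAt_target_mem_nhds p)
  have h2 : ContMDiffAt 𝓘(ℝ, Eu d) 𝓘(ℝ, V) ∞ (s ∘ (extChartAt (𝓡 d) p).symm)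
      (extChartAt (𝓡 d) p p) := by
    apply ContMDiffAt.comp _ _ h1
    simpa using hs
  refine h2.congr_of_eventuallyEq ?_
  filter_upwards [extChartAt_target_mem_nhds p] with y hy using hf y hy

theorem contDiffAt_vectorInChart {p : M} {ξ : ∀ x : M, TangentSpace (𝓡 d) x}
    (hξ : ContMDiff (𝓡 d) ((𝓡 d).prod 𝓘(ℝ, Eu d)) ∞ (fun x => TotalSpace.mk' (Eu d) x (ξ x))) :
    ContDiffAt ℝ ∞ (vectorInChart p ξ) (extChartAt (𝓡 d) p p) := by
  refine contDiffAt_of_eq_comp_symm ((contMDiffAt_section p).1 (hξ p)) fun y hy => ?_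
  change ((chartFrame p y).inverse : Eu d →L[ℝ] Eu d) _ = _
  rw [chartFrame_inverse_eq hy, Trivialization.continuousLinearMapAt_apply,
    Trivialization.linearMapAt_apply, if_pos]
  simpa using symm_mem_chart_source hy

theorem contDiffAt_endInChart {p : M}
    {φ : ∀ x : M, TangentSpace (𝓡 d) x →L[ℝ] TangentSpace (𝓡 d) x}
    (hφ : ContMDiff (𝓡 d) ((𝓡 d).prod 𝓘(ℝ, Eu d →L[ℝ] Eu d)) ∞
      (fun x => TotalSpace.mk' (Eu d →L[ℝ] Eu d) x (φ x))) :
    ContDiffAt ℝ ∞ (endInChart p φ) (extChartAt (𝓡 d) p p) := by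
  refine contDiffAt_of_eq_comp_symm (contMDiffAt_hom_bundle _ |>.1 (hφ p)).2 fun y hy => ?_
  ext1 v
  change ((chartFrame p y).inverse : Eu d →L[ℝ] Eu d)
    (φ _ ((chartFrame p y : Eu d →L[ℝ] Eu d) v)) = _
  rw [chartFrame_inverse_eq hy, chartFrame_eq_symmL hy]
  rfl

theorem contDiffAt_formInChart {p : M} {η : ∀ x : M, TangentSpace (𝓡 d) x →L[ℝ] ℝ}
    (hη : ContMDiff (𝓡 d) ((𝓡 d).prod 𝓘(ℝ, Eu d →L[ℝ] ℝ)) ∞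
      (fun x => TotalSpace.mk' (Eu d →L[ℝ] ℝ) x (η x))) :
    ContDiffAt ℝ ∞ (formInChart p η) (extChartAt (𝓡 d) p p) := by
  refine contDiffAt_of_eq_comp_symm (contMDiffAt_hom_bundle _ |>.1 (hη p)).2 fun y hy => ?_
  ext1 v
  change η _ ((chartFrame p y : Eu d →L[ℝ] Eu d) v) = _
  rw [chartFrame_eq_symmL hy]
  simp [ContinuousLinearMap.inCoordinates]
  rfl

theorem contDiffAt_metricInChart (g : Metric d M) (p : M) :
    ContDiffAt ℝ ∞ (metricInChart g p) (extChartAt (𝓡 d) p p) := by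
  refine contDiffAt_of_eq_comp_symm (contMDiffAt_hom_bundle _ |>.1 (g.contMDiff p)).2
    fun y hy => ?_
  ext1 v
  ext1 w
  have hb : (extChartAt (𝓡 d) p).symm y ∈
    (trivializationAt (Eu d) (TangentSpace (𝓡 d)) p).baseSet := by
    simpa using symm_mem_chart_source hy
  change g.inner _ ((chartFrame p y : Eu d →L[ℝ] Eu d) v)
    ((chartFrame p y : Eu d →L[ℝ] Eu d) w) = _
  rw [chartFrame_eq_symmL hy]
  dsimp only
  rw [inCoordinates_apply_eq₂ hb hb (by simp), ← Trivialization.symmL_apply (R := ℝ) _ hb,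
    ← Trivialization.symmL_apply (R := ℝ) _ hb]
  simp

end Charts

/-! ### Maps between manifolds in charts, and pull-back of forms and metrics. -/

section Maps

variable {d k : ℕ} {M : Type*} [TopologicalSpace M] [ChartedSpace (Eu d) M]
  [IsManifold (𝓡 d) ∞ M] {N : Type*} [TopologicalSpace N] [ChartedSpace (Eu k) N]
  [IsManifold (𝓡 k) ∞ N]

/-- A map between manifolds, read in the preferred charts at `p` and `q`. -/
def mapInChart (p : M) (q : N) (f : M → N) (y : Eu d) : Eu k :=
  extChartAt (𝓡 k) q (f ((extChartAt (𝓡 d) p).symm y))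

theorem hasMFDerivAt_chart_symm {p : M} {y : Eu d}
    (hy : y ∈ (extChartAt (𝓡 d) p).target) :
    HasMFDerivAt 𝓘(ℝ, Eu d) (𝓡 d) (extChartAt (𝓡 d) p).symm y (chartFrame p y) := by
  have h := (mdifferentiableWithinAt_extChartAt_symm hy).hasMFDerivWithinAt
  exact h.hasMFDerivAt (by rw [ModelWithCorners.range_eq_univ]; exact Filter.univ_mem)

variable {p : M} {q : N} {f : M → N} {y : Eu d}

theorem contDiffAt_mapInChart (hf : ContMDiff (𝓡 d) (𝓡 k) ∞ f)
    (hy : y ∈ (extChartAt (𝓡 d) p).target)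
    (hq : f ((extChartAt (𝓡 d) p).symm y) ∈ (extChartAt (𝓡 k) q).source) :
    ContDiffAt ℝ ∞ (mapInChart p q f : Eu d → Eu k) y := by
  rw [← contMDiffAt_iff_contDiffAt]
  have h1 : ContMDiffAt 𝓘(ℝ, Eu d) (𝓡 d) ∞ (extChartAt (𝓡 d) p).symm y :=
    (contMDiffOn_extChartAt_symm p).contMDiffAt
      ((isOpen_extChartAt_target p).mem_nhds hy)
  have h2 : ContMDiffAt (𝓡 k) 𝓘(ℝ, Eu k) ∞ (extChartAt (𝓡 k) q)
      (f ((extChartAt (𝓡 d) p).symm y)) :=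
    contMDiffAt_extChartAt' (by simpa using hq)
  exact h2.comp y ((hf _).comp y h1)

theorem eventually_mem_source (hf : ContMDiff (𝓡 d) (𝓡 k) ∞ f)
    (hy : y ∈ (extChartAt (𝓡 d) p).target)
    (hq : f ((extChartAt (𝓡 d) p).symm y) ∈ (extChartAt (𝓡 k) q).source) :
    ∀ᶠ z in 𝓝 y, z ∈ (extChartAt (𝓡 d) p).target ∧
      f ((extChartAt (𝓡 d) p).symm z) ∈ (extChartAt (𝓡 k) q).source := by
  have hc : ContinuousAt (fun z => f ((extChartAt (𝓡 d) p).symm z)) y :=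
    hf.continuous.continuousAt.comp ((continuousOn_extChartAt_symm p).continuousAt
      ((isOpen_extChartAt_target p).mem_nhds hy))
  filter_upwards [(isOpen_extChartAt_target p).mem_nhds hy,
    hc ((isOpen_extChartAt_source q).mem_nhds hq)] with z h1 h2 using ⟨h1, h2⟩

/-- Near y the map f ∘ (chart at p)⁻¹ is also (chart at q)⁻¹ ∘ `mapInChart`; the chain rule for both
factorizations and uniqueness of the derivative give the formula. -/
theorem chartFrame_mapInChart (hf : ContMDiff (𝓡 d) (𝓡 k) ∞ f)
    (hy : y ∈ (extChartAt (𝓡 d) p).target)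
    (hq : f ((extChartAt (𝓡 d) p).symm y) ∈ (extChartAt (𝓡 k) q).source) (u : Eu d) :
    (chartFrame q (mapInChart p q f y) (fderiv ℝ (mapInChart p q f) y u) : Eu k) =
      mfderiv (𝓡 d) (𝓡 k) f ((extChartAt (𝓡 d) p).symm y) (chartFrame p y u) := by
  have ht : mapInChart p q f y ∈ (extChartAt (𝓡 k) q).target :=
    (extChartAt (𝓡 k) q).map_source hq
  have h1 := ((contDiffAt_mapInChart hf hy hq).differentiableAt (by simp)).hasFDerivAt.hasMFDerivAt
  have h2 := (hasMFDerivAt_chart_symm ht).comp y h1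
  have h3 := ((hf.mdifferentiable (by simp)) ((extChartAt (𝓡 d) p).symm y)).hasMFDerivAt.comp y
    (hasMFDerivAt_chart_symm hy)
  have he : (f ∘ (extChartAt (𝓡 d) p).symm) =ᶠ[𝓝 y]
      ((extChartAt (𝓡 k) q).symm ∘ mapInChart p q f) := by
    filter_upwards [eventually_mem_source hf hy hq] with z hz
    exact ((extChartAt (𝓡 k) q).left_inv hz.2).symm
  have h4 := h2.congr_of_eventuallyEq he
  exact congrArg (fun T : Eu d →L[ℝ] Eu k => T u) (hasMFDerivAt_unique h4 h3)

theorem symm_mapInChart (hq : f ((extChartAt (𝓡 d) p).symm y) ∈ (extChartAt (𝓡 k) q).source) :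
    (extChartAt (𝓡 k) q).symm (mapInChart p q f y) = f ((extChartAt (𝓡 d) p).symm y) :=
  (extChartAt (𝓡 k) q).left_inv hq

theorem formInChart_mapInChart (hf : ContMDiff (𝓡 d) (𝓡 k) ∞ f)
    (η : ∀ x : N, TangentSpace (𝓡 k) x →L[ℝ] ℝ)
    (hy : y ∈ (extChartAt (𝓡 d) p).target)
    (hq : f ((extChartAt (𝓡 d) p).symm y) ∈ (extChartAt (𝓡 k) q).source) :
    formInChart p (fun x => (η (f x)).comp (mfderiv (𝓡 d) (𝓡 k) f x)) y =
      (formInChart q η (mapInChart p q f y)).comp (fderiv ℝ (mapInChart p q f) y) := by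
  ext1 u
  change η _ (mfderiv (𝓡 d) (𝓡 k) f _ (chartFrame p y u)) =
    η _ (chartFrame q (mapInChart p q f y) (fderiv ℝ (mapInChart p q f) y u))
  have h : ∀ x x', x = x' → ∀ v : Eu k, (η x : Eu k →L[ℝ] ℝ) v = (η x' : Eu k →L[ℝ] ℝ) v := by
    rintro x _ rfl v
    rfl
  refine (congrArg (η _) (chartFrame_mapInChart hf hy hq u).symm).trans ?_
  exact h _ _ (symm_mapInChart hq).symm _

theorem metricInChart_mapInChart (hf : ContMDiff (𝓡 d) (𝓡 k) ∞ f) (g : Metric k N)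
    (hy : y ∈ (extChartAt (𝓡 d) p).target)
    (hq : f ((extChartAt (𝓡 d) p).symm y) ∈ (extChartAt (𝓡 k) q).source) (u v : Eu d) :
    metricInChart g q (mapInChart p q f y) (fderiv ℝ (mapInChart p q f) y u)
        (fderiv ℝ (mapInChart p q f) y v) =
      g.inner (f ((extChartAt (𝓡 d) p).symm y))
        (mfderiv (𝓡 d) (𝓡 k) f _ (chartFrame p y u))
        (mfderiv (𝓡 d) (𝓡 k) f _ (chartFrame p y v)) := by
  have h : ∀ x x', x = x' → ∀ a b : Eu k, (g.inner x : Eu k →L[ℝ] Eu k →L[ℝ] ℝ) a b =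
      (g.inner x' : Eu k →L[ℝ] Eu k →L[ℝ] ℝ) a b := by
    rintro x _ rfl a b
    rfl
  refine (h _ _ (symm_mapInChart hq) _ _).trans ?_
  exact congrArg₂ (fun a b : Eu k => (g.inner _ : Eu k →L[ℝ] Eu k →L[ℝ] ℝ) a b)
    (chartFrame_mapInChart hf hy hq u) (chartFrame_mapInChart hf hy hq v)

end Maps

/-! ### Coordinate expressions at the centre of the chart. -/

section Center

variable {d : ℕ} {M : Type*} [TopologicalSpace M] [ChartedSpace (Eu d) M] [IsManifold (𝓡 d) ∞ M]

theorem metricInChart_self (g : Metric d M) (p : M) :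
    metricInChart g p (extChartAt (𝓡 d) p p) = (g.inner p : Eu d →L[ℝ] Eu d →L[ℝ] ℝ) := by
  have h : ∀ x, x = p → ∀ a b : Eu d, (g.inner x : Eu d →L[ℝ] Eu d →L[ℝ] ℝ) a b =
      (g.inner p : Eu d →L[ℝ] Eu d →L[ℝ] ℝ) a b := by
    rintro x rfl a b
    rfl
  have hc : ∀ w, (chartFrame p (extChartAt (𝓡 d) p p) w : Eu d) = w := fun w =>
    congrArg (fun T : Eu d →L[ℝ] Eu d => T w) (chartFrame_self p)
  ext1 u
  ext1 v
  refine (h _ (extChartAt_to_inv p) _ _).trans ?_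
  exact congrArg₂ (fun a b : Eu d => (g.inner p : Eu d →L[ℝ] Eu d →L[ℝ] ℝ) a b) (hc u) (hc v)

theorem endInChart_self (φ : ∀ x : M, TangentSpace (𝓡 d) x →L[ℝ] TangentSpace (𝓡 d) x) (p : M) :
    endInChart p φ (extChartAt (𝓡 d) p p) = (φ p : Eu d →L[ℝ] Eu d) := by
  have h : ∀ x, x = p → ∀ a : Eu d, (φ x : Eu d →L[ℝ] Eu d) a = (φ p : Eu d →L[ℝ] Eu d) a := by
    rintro x rfl a
    rfl
  have hc : ∀ w, (chartFrame p (extChartAt (𝓡 d) p p) w : Eu d) = w := fun w =>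
    congrArg (fun T : Eu d →L[ℝ] Eu d => T w) (chartFrame_self p)
  have hi : ∀ w : Eu d, ((chartFrame p (extChartAt (𝓡 d) p p)).inverse w : Eu d) = w := fun w =>
    (congrArg (fun a : Eu d => ((chartFrame p (extChartAt (𝓡 d) p p)).inverse a : Eu d))
      (hc w).symm).trans (chartFrame_inverse_apply (mem_extChartAt_target p) w)
  ext1 u
  exact (hi _).trans ((h _ (extChartAt_to_inv p) _).trans
    (congrArg (φ p : Eu d →L[ℝ] Eu d) (hc u)))

theorem metricInChart_symm (g : Metric d M) (p : M) (y u v : Eu d) :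
    metricInChart g p y u v = metricInChart g p y v u :=
  g.symm _ (chartFrame p y u) (chartFrame p y v)

theorem metricInChart_pos (g : Metric d M) {p : M} {y : Eu d}
    (hy : y ∈ (extChartAt (𝓡 d) p).target) {v : Eu d} (hv : v ≠ 0) :
    0 < metricInChart g p y v v := by
  refine g.pos _ (chartFrame p y v) fun h0 => hv ?_
  rw [← chartFrame_inverse_apply hy v, h0, map_zero]

theorem isMetricNear_metricInChart (g : Metric d M) (p : M) :
    IsMetricNear (metricInChart g p) (extChartAt (𝓡 d) p p) :=
  ⟨(contDiffAt_metricInChart g p).of_le (by norm_cast),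
    .of_forall fun z u v => metricInChart_symm g p z u v,
    Filter.mem_of_superset (extChartAt_target_mem_nhds p) fun z hz v hv =>
      metricInChart_pos g hz hv⟩

end Center

/-! ### Symmetry of h and φh on a contact metric manifold. -/

section Contact

variable {m : ℕ} {N : Type*} [TopologicalSpace N] [ChartedSpace (Eu (2 * m + 1)) N]
  [IsManifold (𝓡 (2 * m + 1)) ∞ N] (S : AlmostContactMetric m N)

/-- The equation `dη(X, Y) = g(X, φ Y)` in the preferred chart at `p`. -/
theorem contact_in_chart (hS : S.IsContactMetric) {p : N} {z : Eu (2 * m + 1)}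
    (hz : z ∈ (extChartAt (𝓡 (2 * m + 1)) p).target) (u v : Eu (2 * m + 1)) :
    2⁻¹ * (fderiv ℝ (formInChart p S.η) z u v - fderiv ℝ (formInChart p S.η) z v u) =
      metricInChart S.g p z u (endInChart p S.φ z v) := by
  set x := (extChartAt (𝓡 (2 * m + 1)) p).symm z with hx
  -- At x the hypothesis is expressed in the preferred chart at x, not the one at p. The change of
  -- coordinates τ is the identity map read in both charts, and d commutes with pull-back by τ.
  set τ : Eu (2 * m + 1) → Eu (2 * m + 1) := mapInChart p x id with hτ
  have hid : ContMDiff (𝓡 (2 * m + 1)) (𝓡 (2 * m + 1)) ∞ (id : N → N) := contMDiff_id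
  have hq : id ((extChartAt (𝓡 (2 * m + 1)) p).symm z) ∈ (extChartAt (𝓡 (2 * m + 1)) x).source :=
    mem_extChartAt_source x
  have hτz : τ z = extChartAt (𝓡 (2 * m + 1)) x x := rfl
  have hη : ∀ᶠ w in 𝓝 z, formInChart p S.η w = (formInChart x S.η (τ w)).comp (fderiv ℝ τ w) := by
    filter_upwards [eventually_mem_source hid hz hq] with w hw
    rw [hτ, ← formInChart_mapInChart hid S.η hw.1 hw.2]
    congr 1
    funext y
    simp
  have hd : DifferentiableAt ℝ (formInChart x S.η) (τ z) :=
    (contDiffAt_formInChart S.smooth_η).differentiableAt (by simp)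
  have h1 := fderiv_pullback_antisymm hd (contDiffAt_mapInChart hid hz hq) hη u v
  -- The frame of the chart at x is the identity at its centre, so the chain rule for the identity
  -- map identifies Dτ with the frame of the chart at p.
  have hframe : ∀ a, (fderiv ℝ τ z a : Eu (2 * m + 1)) = chartFrame p z a := by
    intro a
    have h2 := chartFrame_mapInChart hid hz hq a
    have h3 : ∀ w, (chartFrame x (extChartAt (𝓡 (2 * m + 1)) x x) w : Eu (2 * m + 1)) = w :=
      fun w => congrArg (fun T : Eu (2 * m + 1) →L[ℝ] Eu (2 * m + 1) => T w) (chartFrame_self x)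
    have h4 := (h3 (fderiv ℝ τ z a)).symm.trans h2
    rw [mfderiv_id] at h4
    exact h4
  have h5 := hS x (chartFrame p z u) (chartFrame p z v)
  rw [h1, hframe, hframe, hτz]
  refine h5.trans ?_
  change _ = S.g.inner x (chartFrame p z u) (chartFrame p z ((chartFrame p z).inverse _))
  rw [chartFrame_apply_inverse hz]
  rfl

theorem isContactNear (hS : S.IsContactMetric) (p : N) :
    IsContactNear (metricInChart S.g p) (endInChart p S.φ) (vectorInChart p S.ξ)
      (formInChart p S.η) (extChartAt (𝓡 (2 * m + 1)) p p) := by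
  have ht := extChartAt_target_mem_nhds (I := 𝓡 (2 * m + 1)) p
  have hJ : ∀ {z}, z ∈ (extChartAt (𝓡 (2 * m + 1)) p).target → ∀ u,
      chartFrame p z (endInChart p S.φ z u) = S.φ _ (chartFrame p z u) :=
    fun hz u => chartFrame_apply_inverse hz _
  have hξ : ∀ {z}, z ∈ (extChartAt (𝓡 (2 * m + 1)) p).target →
      chartFrame p z (vectorInChart p S.ξ z) = S.ξ _ :=
    fun hz => chartFrame_apply_inverse hz _
  have hη : ∀ z u, formInChart p S.η z u = S.η _ (chartFrame p z u) := fun z u => rfl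
  have hg : ∀ z u v, metricInChart S.g p z u v =
    S.g.inner _ (chartFrame p z u) (chartFrame p z v) := fun z u v => rfl
  have hinj : ∀ {z}, z ∈ (extChartAt (𝓡 (2 * m + 1)) p).target → ∀ u v,
      chartFrame p z u = chartFrame p z v → u = v := fun hz u v h => by
    rw [← chartFrame_inverse_apply hz u, h, chartFrame_inverse_apply hz]
  refine ⟨contDiffAt_metricInChart _ _, contDiffAt_endInChart S.smooth_φ,
    contDiffAt_vectorInChart S.smooth_ξ, contDiffAt_formInChart S.smooth_η,
    .of_forall fun z u v => S.g.symm _ _ _, ?_, ?_, ?_, ?_, ?_, ?_, ?_⟩ <;>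
    filter_upwards [ht] with z hz
  · intro u
    apply hinj hz _ _
    rw [hJ hz, hJ hz, S.φ_φ, map_add, map_neg, map_smul, hξ hz]
    rfl
  · rw [hη, hξ hz, S.η_ξ]
  · apply hinj hz _ _
    rw [hJ hz, hξ hz, S.φ_ξ, map_zero]
  · intro u
    rw [hη, hJ hz, S.η_φ]
  · intro u v
    rw [hg, hg, hJ hz, hJ hz, S.skew]
  · intro u
    rw [hg, hξ hz, S.inner_ξ, hη]
  · exact contact_in_chart S hS hz

theorem h_symm (hS : S.IsContactMetric) (p : N) (u v : TangentSpace (𝓡 (2 * m + 1)) p) :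
    S.g.inner p (S.h p u) v = S.g.inner p u (S.h p v) := by
  have h := (isContactNear S hS p).lieDeriv_symm
  rw [metricInChart_self] at h
  specialize h u v
  simp only [AlmostContactMetric.h, smul_apply, map_smul]
  exact congrArg (fun t => (2⁻¹ : ℝ) • t) h

theorem h_anticomm (hS : S.IsContactMetric) (p : N) (u : TangentSpace (𝓡 (2 * m + 1)) p) :
    S.h p (S.φ p u) = -S.φ p (S.h p u) := by
  have h := (isContactNear S hS p).lieDeriv_anticomm
  rw [endInChart_self] at h
  specialize h u
  simp only [AlmostContactMetric.h, smul_apply, map_smul]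
  rw [← smul_neg]
  exact congrArg (fun t : Eu (2 * m + 1) => (2⁻¹ : ℝ) • t) h

/-- With φ skew, h symmetric and hφ = -φh, the adjoint of φh is -hφ = φh. -/
theorem phi_h_symm (hS : S.IsContactMetric) (p : N) (u v : TangentSpace (𝓡 (2 * m + 1)) p) :
    S.g.inner p (S.φ p (S.h p u)) v = S.g.inner p u (S.φ p (S.h p v)) := by
  have h1 := S.skew p (S.h p u) v
  rw [h_symm S hS, h_anticomm S hS, map_neg] at h1
  linarith

end Contact

/-! ### Isometric immersions: the Gauss equation and C-totally real submanifolds. -/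

section Immersion

variable {n k : ℕ} {M : Type*} [TopologicalSpace M] [ChartedSpace (Eu n) M]
  [IsManifold (𝓡 n) ∞ M] {N : Type*} [TopologicalSpace N] [ChartedSpace (Eu k) N]
  [IsManifold (𝓡 k) ∞ N] {g : Metric n M} {g' : Metric k N} {F : M → N}

theorem image_mem_source (F : M → N) (p : M) :
    F ((extChartAt (𝓡 n) p).symm (extChartAt (𝓡 n) p p)) ∈ (extChartAt (𝓡 k) (F p)).source := by
  rw [extChartAt_to_inv]
  exact mem_extChartAt_source _

theorem mapInChart_self (F : M → N) (p : M) :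
    mapInChart p (F p) F (extChartAt (𝓡 n) p p) = extChartAt (𝓡 k) (F p) (F p) := by
  rw [mapInChart, extChartAt_to_inv]

theorem fderiv_mapInChart_self (hF : ContMDiff (𝓡 n) (𝓡 k) ∞ F) (p : M) :
    fderiv ℝ (mapInChart p (F p) F) (extChartAt (𝓡 n) p p) =
      (mfderiv (𝓡 n) (𝓡 k) F p : Eu n →L[ℝ] Eu k) := by
  rw [(hF.mdifferentiable (by simp) p).mfderiv, ModelWithCorners.range_eq_univ, fderivWithin_univ]
  rfl

theorem isIsometricNear (hF : IsIsometricImmersion g g' F) (p : M) :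
    IsIsometricNear (metricInChart g p) (metricInChart g' (F p)) (mapInChart p (F p) F)
      (extChartAt (𝓡 n) p p) where
  metric := isMetricNear_metricInChart g p
  metric' := by
    rw [mapInChart_self]
    exact isMetricNear_metricInChart g' (F p)
  smooth := (contDiffAt_mapInChart hF.smooth (mem_extChartAt_target p)
    (image_mem_source F p)).of_le (by norm_cast)
  isometric := by
    filter_upwards [eventually_mem_source hF.smooth (mem_extChartAt_target p)
      (image_mem_source F p)] with z hz u v
    rw [metricInChart_mapInChart hF.smooth g' hz.1 hz.2, hF.isometric]
    rfl

theorem secondForm_symm (hF : IsIsometricImmersion g g' F) (p : M)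
    (u v : TangentSpace (𝓡 n) p) : secondForm g g' F p u v = secondForm g g' F p v u :=
  (isIsometricNear hF p).secondForm_symm u v

/-- The Gauss equation of an isometric immersion. -/
theorem gauss_equation (hF : IsIsometricImmersion g g' F) (p : M)
    (u v w z : TangentSpace (𝓡 n) p) :
    g.inner p (curvature g p u v w) z =
      g'.inner (F p) (curvature g' (F p) (mfderiv (𝓡 n) (𝓡 k) F p u)
        (mfderiv (𝓡 n) (𝓡 k) F p v) (mfderiv (𝓡 n) (𝓡 k) F p w)) (mfderiv (𝓡 n) (𝓡 k) F p z) +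
      g'.inner (F p) (secondForm g g' F p v w) (secondForm g g' F p u z) -
      g'.inner (F p) (secondForm g g' F p u w) (secondForm g g' F p v z) := by
  have h := (isIsometricNear hF p).gauss
  rw [metricInChart_self, mapInChart_self, metricInChart_self,
    fderiv_mapInChart_self hF.smooth] at h
  exact h u v w z

/-- On a submanifold on which the contact form vanishes, `dη` vanishes as well. -/
theorem inner_phi_eq_zero {m : ℕ} {N : Type*} [TopologicalSpace N]
    [ChartedSpace (Eu (2 * m + 1)) N] [IsManifold (𝓡 (2 * m + 1)) ∞ N]
    {S : AlmostContactMetric m N} (hS : S.IsContactMetric) {F : M → N}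
    (hF : ContMDiff (𝓡 n) (𝓡 (2 * m + 1)) ∞ F) (hreal : IsCTotallyReal (n := n) S F) (p : M)
    (u v : TangentSpace (𝓡 n) p) :
    S.g.inner (F p) (mfderiv (𝓡 n) (𝓡 (2 * m + 1)) F p u)
      (S.φ (F p) (mfderiv (𝓡 n) (𝓡 (2 * m + 1)) F p v)) = 0 := by
  have hp := mem_extChartAt_target (I := 𝓡 n) p
  have hη : ∀ᶠ w in 𝓝 (extChartAt (𝓡 n) p p), (0 : Eu n →L[ℝ] ℝ) =
      (formInChart (F p) S.η (mapInChart p (F p) F w)).comp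
        (fderiv ℝ (mapInChart p (F p) F) w) := by
    filter_upwards [eventually_mem_source hF hp (image_mem_source F p)] with w hw
    rw [← formInChart_mapInChart hF S.η hw.1 hw.2]
    ext1 a
    exact (hreal _ (chartFrame p w a)).symm
  have hd : DifferentiableAt ℝ (formInChart (F p) S.η)
      (mapInChart p (F p) F (extChartAt (𝓡 n) p p)) := by
    rw [mapInChart_self]
    exact (contDiffAt_formInChart S.smooth_η).differentiableAt (by simp)
  -- The pull-back of η is zero near p, so that of dη is zero at p; the contact equation reads dη as
  -- ⟨·, φ·⟩.
  have h1 := fderiv_pullback_antisymm (β := fun _ => 0) hd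
    (contDiffAt_mapInChart hF hp (image_mem_source F p)) hη
  rw [mapInChart_self, fderiv_mapInChart_self hF] at h1
  rw [← hS]
  refine (congrArg (fun t => (2⁻¹ : ℝ) * t) (h1 u v).symm).trans ?_
  simp only [fderiv_fun_const]
  exact (congrArg (fun t => (2⁻¹ : ℝ) * t) (sub_self (0 : ℝ))).trans (mul_zero _)

end Immersion

/-! ### Orthonormal frames and traces. -/

section Frames

/-- An orthonormal family can be completed to an orthonormal basis. -/
theorem exists_orthonormal_extension {V : Type*} [AddCommGroup V] [Module ℝ V]
    [FiniteDimensional ℝ V] {n : ℕ} (hn : Module.finrank ℝ V = n) (B : V →ₗ[ℝ] V →ₗ[ℝ] ℝ)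
    (hs : ∀ u v, B u v = B v u) (hp : ∀ v, v ≠ 0 → 0 < B v v) (s : Set (Fin n)) (v : Fin n → V)
    (hv : ∀ i ∈ s, ∀ j ∈ s, B (v i) (v j) = if i = j then 1 else 0) :
    ∃ e : Fin n → V, (∀ i j, B (e i) (e j) = if i = j then 1 else 0) ∧ ∀ i ∈ s, e i = v i := by
  let core : InnerProductSpace.Core ℝ V :=
    { inner := fun u v => B u v
      conj_inner_symm := fun u v => by simpa using hs v u
      re_inner_nonneg := fun u => by
        by_cases h : u = 0
        · simp [h]
        · simpa using (hp u h).le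
      add_left := fun u v w => by simp
      smul_left := fun u v c => by simp
      definite := fun u hu => by
        by_contra h
        exact (hp u h).ne' hu }
  let _ : NormedAddCommGroup V := core.toNormedAddCommGroup
  let _ : InnerProductSpace ℝ V := InnerProductSpace.ofCore core.toCore
  have hinner : ∀ u v : V, inner ℝ u v = B u v := fun u v => rfl
  have ho : Orthonormal ℝ (s.domRestrict v) := by
    rw [orthonormal_iff_ite]
    rintro ⟨i, hi⟩ ⟨j, hj⟩
    rw [hinner]
    simpa using hv i hi j hj
  obtain ⟨b, hb⟩ := ho.exists_orthonormalBasis_extension_of_card_eq (by simpa using hn)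
  exact ⟨b, fun i j => by rw [← hinner]; exact orthonormal_iff_ite.1 b.orthonormal i j, hb⟩

variable {n : ℕ} {M : Type*} [TopologicalSpace M] [ChartedSpace (Eu n) M] [IsManifold (𝓡 n) ∞ M]

theorem exists_isOrthonormalFrame_extension (g : Metric n M) (p : M) (s : Set (Fin n))
    (v : Fin n → TangentSpace (𝓡 n) p)
    (hv : ∀ i ∈ s, ∀ j ∈ s, g.inner p (v i) (v j) = if i = j then 1 else 0) :
    ∃ e, IsOrthonormalFrame g p e ∧ ∀ i ∈ s, e i = v i := by
  have : FiniteDimensional ℝ (TangentSpace (𝓡 n) p) :=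
    inferInstanceAs (FiniteDimensional ℝ (Eu n))
  have hd : Module.finrank ℝ (TangentSpace (𝓡 n) p) = n := by
    change Module.finrank ℝ (Eu n) = n
    simp
  exact exists_orthonormal_extension hd (LinearMap.mk₂ ℝ (fun u v => g.inner p u v)
    (by simp) (by simp) (by simp) (by simp)) (g.symm p) (g.pos p) s v hv

theorem exists_isOrthonormalFrame (g : Metric n M) (p : M) : ∃ e, IsOrthonormalFrame g p e := by
  obtain ⟨e, he, -⟩ := exists_isOrthonormalFrame_extension g p ∅ (fun _ => 0) (by simp)
  exact ⟨e, he⟩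

theorem exists_isOrthonormalFrame_of_unit (g : Metric n M) (p : M) (i : Fin n)
    {U : TangentSpace (𝓡 n) p} (hU : g.inner p U U = 1) :
    ∃ e, IsOrthonormalFrame g p e ∧ e i = U := by
  obtain ⟨e, he, hi⟩ := exists_isOrthonormalFrame_extension g p {i} (fun _ => U) (by simp [hU])
  exact ⟨e, he, hi i rfl⟩

variable {g : Metric n M} {p : M} {e : Fin n → TangentSpace (𝓡 n) p}

theorem IsOrthonormalFrame.sum_mul (he : IsOrthonormalFrame g p e) (u v : TangentSpace (𝓡 n) p) :
    ∑ j, g.inner p u (e j) * g.inner p v (e j) = g.inner p u v := by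
  conv_rhs => rw [← expand_of_isOrthonormalFrame he v]
  simp [map_sum, mul_comm]

theorem IsOrthonormalFrame.trace_eq_sum (he : IsOrthonormalFrame g p e)
    (A : TangentSpace (𝓡 n) p →ₗ[ℝ] TangentSpace (𝓡 n) p) :
    LinearMap.trace ℝ (TangentSpace (𝓡 n) p) A = ∑ j, g.inner p (A (e j)) (e j) := by
  have hli : LinearIndependent ℝ e := by
    rw [Fintype.linearIndependent_iff]
    intro c hc j
    have h := congrArg (fun w => g.inner p w (e j)) hc
    simpa [map_sum, sum_apply, he _ _] using h
  have hcard : Fintype.card (Fin n) = Module.finrank ℝ (TangentSpace (𝓡 n) p) := by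
    change _ = Module.finrank ℝ (Eu n)
    simp
  have : FiniteDimensional ℝ (TangentSpace (𝓡 n) p) :=
    inferInstanceAs (FiniteDimensional ℝ (Eu n))
  let b := basisOfLinearIndependentOfCardEqFinrank' e hli hcard
  have hb : ∀ j, b j = e j := fun j => by simp [b]
  have hr : ∀ v j, b.repr v j = g.inner p v (e j) := by
    intro v j
    conv_rhs => rw [← b.sum_repr v]
    simp [map_sum, sum_apply, hb, he _ _]
  rw [LinearMap.trace_eq_matrix_trace ℝ b, Matrix.trace]
  refine Finset.sum_congr rfl fun j _ => ?_
  rw [Matrix.diag_apply, LinearMap.toMatrix_apply, hr, hb]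

theorem IsOrthonormalFrame.ricci_eq_sum (he : IsOrthonormalFrame g p e)
    (U : TangentSpace (𝓡 n) p) :
    ricci g p U = ∑ j, g.inner p (curvature g p (e j) U U) (e j) :=
  he.trace_eq_sum (jacobiOperator g p U)

end Frames

/-! ### Tangential parts and the algebra of the Ricci defect. -/

section Ricci

variable {n k : ℕ} {M : Type*} [TopologicalSpace M] [ChartedSpace (Eu n) M]
  [IsManifold (𝓡 n) ∞ M] {N : Type*} [TopologicalSpace N] [ChartedSpace (Eu k) N]
  [IsManifold (𝓡 k) ∞ N]

theorem inner_tangentialEnd (g : Metric n M) (g' : Metric k N) (F : M → N) (p : M)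
    (A : TangentSpace (𝓡 k) (F p) →L[ℝ] TangentSpace (𝓡 k) (F p)) (u v : TangentSpace (𝓡 n) p) :
    g.inner p (tangentialEnd g g' F p A u) v =
      g'.inner (F p) (A (mfderiv (𝓡 n) (𝓡 k) F p u)) (mfderiv (𝓡 n) (𝓡 k) F p v) :=
  congrArg (fun α : Eu n →L[ℝ] ℝ => α v)
    (apply_inverse_of_pos (E := Eu n) (B := g.inner p) (g.pos p)
      ((g'.inner (F p) (A (mfderiv (𝓡 n) (𝓡 k) F p u))).comp (mfderiv (𝓡 n) (𝓡 k) F p)))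

/-- The amount by which the Ricci curvature falls short of its upper bound. -/
theorem ricci_defect {W : Type*} [AddCommGroup W] [Module ℝ W] (B : W →ₗ[ℝ] W →ₗ[ℝ] ℝ)
    (hB : ∀ u v, B u v = B v u) (s : Fin n → Fin n → W) (i : Fin n) (hs : ∀ j, s j i = s i j) :
    ∑ j, (B (s i i) (s j j) - B (s j i) (s i j)) =
      1 / 4 * B (∑ j, s j j) (∑ j, s j j) -
        (B ((2⁻¹ : ℝ) • (∑ j, s j j) - s i i) ((2⁻¹ : ℝ) • (∑ j, s j j) - s i i) +
          ∑ j ∈ Finset.univ.erase i, B (s i j) (s i j)) := by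
  -- With a = s i i and T = Σ_j s j j, splitting off j = i leaves ⟨a, T⟩ - |a|² = ¼|T|² - |T/2 -
  -- a|².
  rw [Finset.sum_sub_distrib, ← map_sum (B (s i i)),
    ← Finset.add_sum_erase _ (fun j => B (s j i) (s i j)) (Finset.mem_univ i)]
  simp only [hs, map_sub, map_smul, LinearMap.sub_apply, LinearMap.smul_apply, smul_eq_mul]
  rw [hB (∑ j, s j j) (s i i)]
  ring

end Ricci

/-! ### The Ricci inequality and its equality cases. -/

section Main

variable {m n : ℕ} {N : Type*} [TopologicalSpace N] [ChartedSpace (Eu (2 * m + 1)) N]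
  [IsManifold (𝓡 (2 * m + 1)) ∞ N] {M : Type*} [TopologicalSpace M] [ChartedSpace (Eu n) M]
  [IsManifold (𝓡 n) ∞ M] {S : AlmostContactMetric m N}
  {f₁ f₂ f₃ f₄ f₅₁ f₅₂ f₆ : N → ℝ} {g : Metric n M} {F : M → N}

/-- The curvature of the ambient space form on tangent vectors of a C-totally real submanifold. -/
theorem inner_curvature_tangent (hS : S.IsContactMetric)
    (hf : S.IsDividedSpaceForm f₁ f₂ f₃ f₄ f₅₁ f₅₂ f₆)
    (hF : IsIsometricImmersion g S.g F) (hreal : IsCTotallyReal (n := n) S F) (p : M)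
    (X U : TangentSpace (𝓡 n) p) (hX : g.inner p X X = 1) (hU : g.inner p U U = 1) :
    S.g.inner (F p) (curvature S.g (F p) (mfderiv (𝓡 n) (𝓡 (2 * m + 1)) F p X)
        (mfderiv (𝓡 n) (𝓡 (2 * m + 1)) F p U) (mfderiv (𝓡 n) (𝓡 (2 * m + 1)) F p U))
        (mfderiv (𝓡 n) (𝓡 (2 * m + 1)) F p X) =
      f₁ (F p) * (1 - g.inner p U X * g.inner p U X) +
      f₄ (F p) * (g.inner p (hT S g F p X) X - 2 * (g.inner p (hT S g F p U) X * g.inner p U X) +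
        g.inner p (hT S g F p U) U) +
      f₅₁ (F p) * (g.inner p (hT S g F p U) U * g.inner p (hT S g F p X) X -
        g.inner p (hT S g F p U) X * g.inner p (hT S g F p U) X) +
      f₅₂ (F p) * (g.inner p (phihT S g F p U) U * g.inner p (phihT S g F p X) X -
        g.inner p (phihT S g F p U) X * g.inner p (phihT S g F p U) X) := by
  have hφ := inner_phi_eq_zero hS hF.smooth hreal p
  have hη := hreal p
  have hg := hF.isometric p
  have hh : ∀ u v, g.inner p (hT S g F p u) v = _ := inner_tangentialEnd g S.g F p (S.h (F p))
  have hφh : ∀ u v, g.inner p (phihT S g F p u) v = _ :=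
    inner_tangentialEnd g S.g F p ((S.φ (F p)).comp (S.h (F p)))
  -- Symmetry of h and φh merges the mixed terms ⟨hX, U⟩, ⟨hU, X⟩ and their φh analogues into
  -- products and squares.
  have e1 := (h_symm S hS (F p) (mfderiv (𝓡 n) (𝓡 (2 * m + 1)) F p X)
    (mfderiv (𝓡 n) (𝓡 (2 * m + 1)) F p U)).trans (S.g.symm _ _ _)
  have e2 := (phi_h_symm S hS (F p) (mfderiv (𝓡 n) (𝓡 (2 * m + 1)) F p X)
    (mfderiv (𝓡 n) (𝓡 (2 * m + 1)) F p U)).trans (S.g.symm _ _ _)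
  have e4 := g.symm p X U
  rw [hf]
  simp only [AlmostContactMetric.R1, AlmostContactMetric.R2, AlmostContactMetric.R3,
    AlmostContactMetric.R4, AlmostContactMetric.R51, AlmostContactMetric.R52,
    AlmostContactMetric.R6, hφ, hη, hh, hφh, map_add, map_sub, map_smul, add_apply, sub_apply,
    smul_apply, smul_eq_mul, hg, hX, hU, mul_zero, zero_smul, smul_zero, sub_zero,
    add_zero, ContinuousLinearMap.comp_apply]
  rw [e1, e2, e4]
  ring

/-- The Ricci curvature of a C-totally real submanifold in terms of an orthonormal frame. -/
theorem ricci_eq_bound_sub (hn : n ≠ 0) (hS : S.IsContactMetric)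
    (hf : S.IsDividedSpaceForm f₁ f₂ f₃ f₄ f₅₁ f₅₂ f₆)
    (hF : IsIsometricImmersion g S.g F) (hreal : IsCTotallyReal (n := n) S F) (p : M)
    {e : Fin n → TangentSpace (𝓡 n) p} (he : IsOrthonormalFrame g p e) (i : Fin n) :
    ricci g p (e i) = ricciBound S f₁ f₄ f₅₁ f₅₂ g F p (e i) -
      (S.g.inner (F p)
          (((n : ℝ) / 2) • meanCurvature g S.g F p - secondForm g S.g F p (e i) (e i))
          (((n : ℝ) / 2) • meanCurvature g S.g F p - secondForm g S.g F p (e i) (e i)) +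
        ∑ j ∈ Finset.univ.erase i, S.g.inner (F p) (secondForm g S.g F p (e i) (e j))
          (secondForm g S.g F p (e i) (e j))) := by
  have hn' : (n : ℝ) ≠ 0 := Nat.cast_ne_zero.2 hn
  have hU : g.inner p (e i) (e i) = 1 := by simp [he i i]
  have hH : ∑ j, secondForm g S.g F p (e j) (e j) = (n : ℝ) • meanCurvature g S.g F p := by
    rw [meanCurvature_eq_sum he, smul_smul, mul_inv_cancel₀ hn', one_smul]
  have hdef := ricci_defect (LinearMap.mk₂ ℝ (fun u v => S.g.inner (F p) u v)
    (by simp) (by simp) (by simp) (by simp)) (S.g.symm (F p))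
    (fun a b => secondForm g S.g F p (e a) (e b)) i (fun j => secondForm_symm hF p _ _)
  simp only [hH, LinearMap.mk₂_apply, smul_smul] at hdef
  rw [show (2⁻¹ : ℝ) * n = n / 2 by ring] at hdef
  -- The index j = i is kept, since its term is zero; the sums over all j are then full traces.
  have hamb := fun j => inner_curvature_tangent hS hf hF hreal p (e j) (e i)
    (by simp [he j j]) hU
  have hsum : ricci g p (e i) = ∑ j, S.g.inner (F p)
        (curvature S.g (F p) (mfderiv (𝓡 n) (𝓡 (2 * m + 1)) F p (e j))
        (mfderiv (𝓡 n) (𝓡 (2 * m + 1)) F p (e i)) (mfderiv (𝓡 n) (𝓡 (2 * m + 1)) F p (e i)))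
        (mfderiv (𝓡 n) (𝓡 (2 * m + 1)) F p (e j)) +
      ∑ j, (S.g.inner (F p) (secondForm g S.g F p (e i) (e i)) (secondForm g S.g F p (e j) (e j)) -
        S.g.inner (F p) (secondForm g S.g F p (e j) (e i))
          (secondForm g S.g F p (e i) (e j))) := by
    rw [he.ricci_eq_sum, ← Finset.sum_add_distrib]
    refine Finset.sum_congr rfl fun j _ => ?_
    rw [gauss_equation hF]
    ring
  rw [hsum, hdef]
  -- Parseval evaluates the sums of products: Σ_j ⟨U, e_j⟩² = 1 gives n - 1 for f₁, Σ_j ⟨hU, e_j⟩⟨U,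
  -- e_j⟩ = ⟨hU, U⟩ gives n - 2 for f₄, and Σ_j ⟨hU, e_j⟩² is the squared norm of the tangential
  -- part of hU.
  simp only [hamb, Finset.sum_add_distrib, ← Finset.mul_sum, Finset.sum_sub_distrib, he.sum_mul,
    ← he.trace_eq_sum, hU]
  simp only [ricciBound, map_smul, smul_apply, smul_eq_mul, Finset.sum_const, Finset.card_univ,
    Fintype.card_fin, nsmul_eq_mul]
  ring

/-- The equality case of the inequality for the Ricci curvature. -/
theorem ricci_eq_bound_iff (hn : n ≠ 0) (hS : S.IsContactMetric)
    (hf : S.IsDividedSpaceForm f₁ f₂ f₃ f₄ f₅₁ f₅₂ f₆)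
    (hF : IsIsometricImmersion g S.g F) (hreal : IsCTotallyReal (n := n) S F) (p : M)
    {U : TangentSpace (𝓡 n) p} (hU : g.inner p U U = 1) :
    ricci g p U = ricciBound S f₁ f₄ f₅₁ f₅₂ g F p U ↔
      secondForm g S.g F p U U = ((n : ℝ) / 2) • meanCurvature g S.g F p ∧
        ∀ V, g.inner p U V = 0 → secondForm g S.g F p U V = 0 := by
  have hnn : ∀ v, 0 ≤ S.g.inner (F p) v v := fun v => by
    by_cases h : v = 0
    · simp [h]
    · exact (S.g.pos _ _ h).le
  have hdf : ∀ {v}, S.g.inner (F p) v v = 0 → v = 0 := fun {v} hv => by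
    by_contra h
    exact (S.g.pos _ _ h).ne' hv
  -- The position of U in the frame is immaterial; index 0 exists because n ≠ 0.
  obtain ⟨e, he, rfl⟩ := exists_isOrthonormalFrame_of_unit g p ⟨0, Nat.pos_of_ne_zero hn⟩ hU
  obtain ⟨σ, hσ⟩ : ∃ σ : TangentSpace (𝓡 n) p →ₗ[ℝ] TangentSpace (𝓡 n) p →ₗ[ℝ]
      TangentSpace (𝓡 (2 * m + 1)) (F p), ∀ u v, secondForm g S.g F p u v = σ u v :=
    coordSecondForm_bilinear (E := Eu n) (E' := Eu (2 * m + 1)) _ _ _ _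
  rw [ricci_eq_bound_sub hn hS hf hF hreal p he, sub_eq_self,
    add_eq_zero_iff_of_nonneg (hnn _) (Finset.sum_nonneg fun j _ => hnn _),
    Finset.sum_eq_zero_iff_of_nonneg fun j _ => hnn _]
  constructor
  · rintro ⟨h1, h2⟩
    refine ⟨(sub_eq_zero.1 (hdf h1)).symm, fun V hV => ?_⟩
    rw [hσ, ← expand_of_isOrthonormalFrame he V, map_sum]
    refine Finset.sum_eq_zero fun j _ => ?_
    rw [map_smul, ← hσ]
    by_cases hj : j = ⟨0, Nat.pos_of_ne_zero hn⟩
    · rw [hj, g.symm, hV, zero_smul]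
    · rw [hdf (h2 j (Finset.mem_erase.2 ⟨hj, Finset.mem_univ j⟩)), smul_zero]
  · rintro ⟨h1, h2⟩
    refine ⟨by rw [h1]; simp, fun j hj => ?_⟩
    rw [h2 _ (by rw [he, if_neg (Finset.ne_of_mem_erase hj).symm])]
    simp

theorem ricci_le_bound (hn : n ≠ 0) (hS : S.IsContactMetric)
    (hf : S.IsDividedSpaceForm f₁ f₂ f₃ f₄ f₅₁ f₅₂ f₆)
    (hF : IsIsometricImmersion g S.g F) (hreal : IsCTotallyReal (n := n) S F) (p : M)
    {U : TangentSpace (𝓡 n) p} (hU : g.inner p U U = 1) :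
    ricci g p U ≤ ricciBound S f₁ f₄ f₅₁ f₅₂ g F p U := by
  have hnn : ∀ v, 0 ≤ S.g.inner (F p) v v := fun v => by
    by_cases h : v = 0
    · simp [h]
    · exact (S.g.pos _ _ h).le
  obtain ⟨e, he, rfl⟩ := exists_isOrthonormalFrame_of_unit g p ⟨0, Nat.pos_of_ne_zero hn⟩ hU
  rw [ricci_eq_bound_sub hn hS hf hF hreal p he, sub_le_self_iff]
  exact add_nonneg (hnn _) (Finset.sum_nonneg fun j _ => hnn _)

/-- Split Y into its component along U and an orthogonal remainder. The right side is the equality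
criterion of `ricci_eq_bound_iff` at H = 0. -/
theorem mem_relativeNullSpace_iff (p : M) {U : TangentSpace (𝓡 n) p} (hU : g.inner p U U = 1) :
    U ∈ relativeNullSpace g S.g F p ↔ secondForm g S.g F p U U = 0 ∧
      ∀ V, g.inner p U V = 0 → secondForm g S.g F p U V = 0 := by
  obtain ⟨σ, hσ⟩ : ∃ σ : TangentSpace (𝓡 n) p →ₗ[ℝ] TangentSpace (𝓡 n) p →ₗ[ℝ]
      TangentSpace (𝓡 (2 * m + 1)) (F p), ∀ u v, secondForm g S.g F p u v = σ u v :=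
    coordSecondForm_bilinear (E := Eu n) (E' := Eu (2 * m + 1)) _ _ _ _
  refine ⟨fun h => ⟨h U, fun V _ => h V⟩, fun ⟨h1, h2⟩ Y => ?_⟩
  have h3 := h2 (Y - g.inner p U Y • U) (by simp [hU])
  rw [hσ] at h1 h3 ⊢
  rw [map_sub, map_smul, h1, smul_zero, sub_zero] at h3
  exact h3

theorem isTotallyGeodesicAt_of_frame {p : M} {e : Fin n → TangentSpace (𝓡 n) p}
    (he : IsOrthonormalFrame g p e) (h : ∀ i, e i ∈ relativeNullSpace g S.g F p) :
    IsTotallyGeodesicAt g S.g F p := by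
  obtain ⟨σ, hσ⟩ : ∃ σ : TangentSpace (𝓡 n) p →ₗ[ℝ] TangentSpace (𝓡 n) p →ₗ[ℝ]
      TangentSpace (𝓡 (2 * m + 1)) (F p), ∀ u v, secondForm g S.g F p u v = σ u v :=
    coordSecondForm_bilinear (E := Eu n) (E' := Eu (2 * m + 1)) _ _ _ _
  intro X Y
  rw [hσ, ← expand_of_isOrthonormalFrame he X, map_sum, LinearMap.sum_apply]
  refine Finset.sum_eq_zero fun j _ => ?_
  rw [map_smul, LinearMap.smul_apply, ← hσ, h j Y, smul_zero]

/-- Equality in all directions holds at totally geodesic points and, on surfaces, at totally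
umbilical points only. -/
theorem ricci_eq_bound_forall_iff (hn : n ≠ 0) (hS : S.IsContactMetric)
    (hf : S.IsDividedSpaceForm f₁ f₂ f₃ f₄ f₅₁ f₅₂ f₆)
    (hF : IsIsometricImmersion g S.g F) (hreal : IsCTotallyReal (n := n) S F) (p : M) :
    (∀ U : TangentSpace (𝓡 n) p, g.inner p U U = 1 →
        ricci g p U = ricciBound S f₁ f₄ f₅₁ f₅₂ g F p U) ↔
      IsTotallyGeodesicAt g S.g F p ∨ (n = 2 ∧ IsTotallyUmbilicalAt g S.g F p) := by
  have hn' : (n : ℝ) ≠ 0 := Nat.cast_ne_zero.2 hn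
  obtain ⟨e, he⟩ := exists_isOrthonormalFrame g p
  have he1 : ∀ i, g.inner p (e i) (e i) = 1 := fun i => by simp [he i i]
  have hH : (n : ℝ) • meanCurvature g S.g F p = ∑ j, secondForm g S.g F p (e j) (e j) := by
    rw [meanCurvature_eq_sum he, smul_smul, mul_inv_cancel₀ hn', one_smul]
  obtain ⟨σ, hσ⟩ : ∃ σ : TangentSpace (𝓡 n) p →ₗ[ℝ] TangentSpace (𝓡 n) p →ₗ[ℝ]
      TangentSpace (𝓡 (2 * m + 1)) (F p), ∀ u v, secondForm g S.g F p u v = σ u v :=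
    coordSecondForm_bilinear (E := Eu n) (E' := Eu (2 * m + 1)) _ _ _ _
  constructor
  · intro h
    have h1 := fun i => (ricci_eq_bound_iff hn hS hf hF hreal p (he1 i)).1 (h _ (he1 i))
    by_cases hH0 : meanCurvature g S.g F p = 0
    · refine .inl (isTotallyGeodesicAt_of_frame he fun i => ?_)
      rw [mem_relativeNullSpace_iff p (he1 i)]
      have h2 := h1 i
      rwa [hH0, smul_zero] at h2
    · have hn2 : n = 2 := by
        -- Summing σ(e_i, e_i) = (n/2)H over the frame gives nH = n(n/2)H, and H ≠ 0 can be
        -- cancelled.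
        simp only [fun i => (h1 i).1, Finset.sum_const, Finset.card_univ, Fintype.card_fin] at hH
        rw [← Nat.cast_smul_eq_nsmul ℝ, smul_smul] at hH
        have h3 : (n : ℝ) = n * (n / 2) := smul_left_injective ℝ hH0 hH
        have h4 : (n : ℝ) = 2 := by
          field_simp at h3
          linarith
        exact_mod_cast h4
      refine .inr ⟨hn2, fun X Y => ?_⟩
      -- For n = 2 the criterion reads σ(e_i, e_i) = H and σ(e_i, V) = 0 for V ⊥ e_i, so only the
      -- e_i-component of Y contributes.
      have h5 : ∀ i, σ (e i) Y = g.inner p Y (e i) • meanCurvature g S.g F p := by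
        intro i
        have h6 := (h1 i).2 (Y - g.inner p (e i) Y • e i) (by simp [he1])
        have h7 := (h1 i).1
        rw [hσ] at h6 h7
        rw [map_sub, map_smul, h7, sub_eq_zero] at h6
        rw [h6, show (n : ℝ) / 2 = 1 by rw [hn2]; norm_num, one_smul, g.symm]
      rw [hσ]
      conv_lhs => rw [← expand_of_isOrthonormalFrame he X]
      simp only [map_sum, map_smul, LinearMap.sum_apply, LinearMap.smul_apply, h5, smul_smul]
      rw [← Finset.sum_smul, he.sum_mul]
  · rintro (h | ⟨hn2, h⟩) U hU <;> rw [ricci_eq_bound_iff hn hS hf hF hreal p hU]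
    · have hH0 : meanCurvature g S.g F p = 0 := by
        rw [meanCurvature_eq_sum he]
        simp [h _ _]
      exact ⟨by rw [h, hH0, smul_zero], fun V _ => h U V⟩
    · refine ⟨?_, fun V hV => by rw [h, hV, zero_smul]⟩
      rw [h, hU, show (n : ℝ) / 2 = 1 by rw [hn2]; norm_num]

end Main

end KappaMu

end

theorem mainTheorem2 {m n : ℕ} (hn : 2 ≤ n)
    {N : Type*} [TopologicalSpace N] [ChartedSpace (KappaMu.Eu (2 * m + 1)) N]
    [IsManifold (𝓡 (2 * m + 1)) ∞ N]
    {M : Type*} [TopologicalSpace M] [ChartedSpace (KappaMu.Eu n) M] [IsManifold (𝓡 n) ∞ M]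
    (S : KappaMu.AlmostContactMetric m N) (hS : S.IsContactMetric)
    (f₁ f₂ f₃ f₄ f₅₁ f₅₂ f₆ : N → ℝ) (hf : S.IsDividedSpaceForm f₁ f₂ f₃ f₄ f₅₁ f₅₂ f₆)
    (g : KappaMu.Metric n M) (F : M → N) (hF : KappaMu.IsIsometricImmersion g S.g F)
    (hreal : KappaMu.IsCTotallyReal (n := n) S F) (p : M) :
    (∀ U : TangentSpace (𝓡 n) p, g.inner p U U = 1 →
      KappaMu.ricci g p U ≤ KappaMu.ricciBound S f₁ f₄ f₅₁ f₅₂ g F p U) ∧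
    (KappaMu.meanCurvature g S.g F p = 0 →
      ∀ U : TangentSpace (𝓡 n) p, g.inner p U U = 1 →
        (KappaMu.ricci g p U = KappaMu.ricciBound S f₁ f₄ f₅₁ f₅₂ g F p U ↔
          U ∈ KappaMu.relativeNullSpace g S.g F p)) ∧
    ((∀ U : TangentSpace (𝓡 n) p, g.inner p U U = 1 →
        KappaMu.ricci g p U = KappaMu.ricciBound S f₁ f₄ f₅₁ f₅₂ g F p U) ↔
      KappaMu.IsTotallyGeodesicAt g S.g F p ∨
        (n = 2 ∧ KappaMu.IsTotallyUmbilicalAt g S.g F p)) := by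
  have hn0 : n ≠ 0 := by omega
  refine ⟨fun U hU => KappaMu.ricci_le_bound hn0 hS hf hF hreal p hU, fun hH U hU => ?_,
    KappaMu.ricci_eq_bound_forall_iff hn0 hS hf hF hreal p⟩
  rw [KappaMu.ricci_eq_bound_iff hn0 hS hf hF hreal p hU,
    KappaMu.mem_relativeNullSpace_iff p hU, hH, smul_zero]
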